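/- A \emph{hexagon} of a graph is a subgraph that is a cycle of length $6$. A \emph{benzenoid graph} is a finite $2$-connected graph that can be embedded in the plane so that every inner face is bounded by a hexagon and every hexagon bounds an inner face, such that any two distinct hexagons are either disjoint or meet in exactly one edge (together with its two ends), and no three hexagons share a common edge. (Such a graph need not be a subgraph of the regular hexagonal lattice.) A benzenoid graph is \emph{catacondensed} if no vertex is shared by three hexagons. For a perfect matching $M$ of a graph $B$, a hexagon of $B$ is \emph{$M$-alternating} if exactly three of its edges belong to $M$. The \emph{Clar number} $\mathrm{Cl}(B)$ is the maximum, over all perfect matchings $M$ of $B$, of the number of hexagons in a set of pairwise vertex-disjoint $M$-alternating hexagons of $B$. \textbf{Theorem.} Let $n$ be a positive integer. Then for every integer $c$ with $1\le c\le \left\lfloor \frac{2n+1}{3}\right\rfloor$ there exists a catacondensed benzenoid graph $B$ with exactly $n$ hexagons and with Clar number $\mathrm{Cl}(B)=c$. -/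

import Mathlib

namespace SimpleGraph

variable {V : Type*}

/-- A graph is 2-connected if it has at least three vertices, is connected, and stays connected
after the deletion of any one vertex. -/
structure IsTwoConnected (G : SimpleGraph V) : Prop where
  three_le_card : 3 ≤ Nat.card V
  connected : G.Connected
  connected_delete : ∀ v : V, (G.induce {v}ᶜ).Connected

/-- A rotation system: a permutation of the darts (oriented edges) whose cycles are exactly the
sets of darts leaving a common vertex. It gives the cyclic order of the edges around each vertex
in an embedding of the graph into an oriented surface. -/
structure RotationSystem (G : SimpleGraph V) where
  rot : Equiv.Perm G.Dart
  sameCycle_iff : ∀ d d' : G.Dart, rot.SameCycle d d' ↔ d.fst = d'.fst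

namespace RotationSystem

variable {G : SimpleGraph V}

/-- Face tracing: walk along a dart, then turn to the next dart at its end vertex. -/
def facePerm (R : RotationSystem G) : Equiv.Perm G.Dart :=
  (Function.Involutive.toPerm Dart.symm Dart.symm_involutive).trans R.rot

/-- The faces of the embedding are the orbits of face tracing. -/
def Face (R : RotationSystem G) : Type _ :=
  Quotient (Equiv.Perm.SameCycle.setoid R.facePerm)

/-- The face on whose boundary a dart lies. -/
def faceOf (R : RotationSystem G) (d : G.Dart) : R.Face :=
  Quotient.mk (Equiv.Perm.SameCycle.setoid R.facePerm) d

/-- The boundary of a face: the subgraph formed by all its edges and their ends. -/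
def boundary (R : RotationSystem G) (F : R.Face) : G.Subgraph :=
  ⨆ d : {d : G.Dart // R.faceOf d = F}, G.subgraphOfAdj d.1.adj

/-- The surface given by a rotation system of a connected finite graph is the sphere exactly
when Euler's formula `|V| - |E| + |F| = 2` holds. -/
def IsSpherical (R : RotationSystem G) : Prop :=
  (Nat.card V : ℤ) - (G.edgeSet.ncard : ℤ) + (Nat.card R.Face : ℤ) = 2

end RotationSystem

/-- An embedding of a connected finite graph in the plane, up to homeomorphism: a rotation system
of genus zero with a choice of the outer face. -/
structure PlaneEmbedding (G : SimpleGraph V) extends RotationSystem G where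
  spherical : toRotationSystem.IsSpherical
  outer : toRotationSystem.Face

/-- A hexagon of `G` is a subgraph that is a cycle of length 6. -/
def IsHexagon {G : SimpleGraph V} (H : G.Subgraph) : Prop :=
  Nonempty (H.coe ≃g cycleGraph 6)

/-- A benzenoid graph: a 2-connected finite graph that can be drawn in the plane in such a way
that all inner faces are hexagons and all hexagons are inner faces, where two hexagons are
either disjoint or meet in exactly one edge, and no three hexagons share an edge. -/
structure IsBenzenoid (G : SimpleGraph V) : Prop where
  finite : Finite V
  twoConnected : G.IsTwoConnected
  exists_embedding : ∃ P : PlaneEmbedding G,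
    (∀ F : P.Face, F ≠ P.outer → IsHexagon (P.boundary F)) ∧
    (∀ H : G.Subgraph, IsHexagon H → ∃ F : P.Face, F ≠ P.outer ∧ P.boundary F = H)
  inter : ∀ H₁ H₂ : G.Subgraph, IsHexagon H₁ → IsHexagon H₂ → H₁ ≠ H₂ →
    Disjoint H₁.verts H₂.verts ∨ ∃ (u v : V) (h : G.Adj u v), H₁ ⊓ H₂ = G.subgraphOfAdj h
  no_three : ∀ H₁ H₂ H₃ : G.Subgraph, IsHexagon H₁ → IsHexagon H₂ → IsHexagon H₃ →
    H₁ ≠ H₂ → H₁ ≠ H₃ → H₂ ≠ H₃ → H₁.edgeSet ∩ H₂.edgeSet ∩ H₃.edgeSet = ∅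

/-- A vertex is internal if it is shared by three different hexagons. -/
def IsInternalVertex (G : SimpleGraph V) (v : V) : Prop :=
  ∃ H₁ H₂ H₃ : G.Subgraph, IsHexagon H₁ ∧ IsHexagon H₂ ∧ IsHexagon H₃ ∧
    H₁ ≠ H₂ ∧ H₁ ≠ H₃ ∧ H₂ ≠ H₃ ∧ v ∈ H₁.verts ∧ v ∈ H₂.verts ∧ v ∈ H₃.verts

/-- A catacondensed benzenoid graph: one without internal vertices. -/
def IsCatacondensedBenzenoid (G : SimpleGraph V) : Prop :=
  G.IsBenzenoid ∧ ∀ v : V, ¬ G.IsInternalVertex v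

/-- The number of hexagons of a graph. -/
noncomputable def numHexagons (G : SimpleGraph V) : ℕ :=
  {H : G.Subgraph | IsHexagon H}.ncard

/-- A hexagon is `M`-alternating if `M` contains exactly three of its edges. -/
def IsAlternatingHexagon {G : SimpleGraph V} (M H : G.Subgraph) : Prop :=
  (H.edgeSet ∩ M.edgeSet).ncard = 3

/-- `C` is a set of pairwise disjoint hexagons that are all `M`-alternating for one and the same
perfect matching `M`. -/
def IsResonantSet {G : SimpleGraph V} (C : Finset G.Subgraph) : Prop :=
  (∀ H ∈ C, IsHexagon H) ∧
  (∀ H₁ ∈ C, ∀ H₂ ∈ C, H₁ ≠ H₂ → Disjoint H₁.verts H₂.verts) ∧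
  ∃ M : G.Subgraph, M.IsPerfectMatching ∧ ∀ H ∈ C, IsAlternatingHexagon M H

/-- The Clar number of `G` is `c`: the largest number of hexagons in a set of independent
`M`-alternating hexagons, over all perfect matchings `M` of `G`, exists and equals `c`. -/
def HasClarNumber (G : SimpleGraph V) (c : ℕ) : Prop :=
  IsGreatest {k : ℕ | ∃ C : Finset G.Subgraph, IsResonantSet C ∧ C.card = k} c

end SimpleGraph

namespace SimpleGraph

/-! Start with one hexagon and glue on the others one at a time, each along an edge `{att i, att i +
1}` and each bringing four new vertices. If the glued edges are pairwise disjoint, the result is a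
catacondensed benzenoid (`isCatacondensedBenzenoid`). An explicit rotation at each vertex traces the
`n` hexagons and one further face, and `(4n + 2) - (5n + 1) + (n + 1) = 2`. The further face is
bounded by a Hamiltonian cycle, which gives 2-connectedness. No unintended hexagon arises
(`isHexagon_iff`): the hexagon that introduced the greatest vertex of a 6-cycle is forced to be the
whole cycle.

For the Clar number, write `n = s + 1 + r`. The hexagons `0, …, s` form a straight chain, which
continues straight into a branching hexagon `s + 1`; the other `r - 1` hexagons continue the
caterpillar, and every third one branches. Matched edges propagate along the straight chain, so it
holds at most one hexagon of a resonant set (`chain_unique`). The last `r` hexagons together have at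
most `4r + 2` vertices, so at most `(2r + 1) / 3` of them are disjoint
(`card_le_of_pairwise_disjoint`).

Conversely, hexagon `0` and the non-branching hexagons after `s + 1` are disjoint and all alternate
for the matching `2t ~ 2t + 1`, since they are glued at even vertices. They number `1 + ⌊2r / 3⌋`,
which meets the upper bound unless `r ≡ 1 (mod 3)`. The values of `r` in the other two residue
classes reach every `c`, and the chain absorbs the remaining hexagons. -/

/-- The combinatorial data of a catacondensed benzenoid built by successively gluing hexagons.
Hexagon `i` has the consecutive vertices
`att i, 4 * i + 2, 4 * i + 3, 4 * i + 4, 4 * i + 5, att i + 1`; for `0 < i` the edge from `att i`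
to `att i + 1` is shared with an earlier hexagon. -/
structure HexTree where
  att : ℕ → ℕ
  att_zero : att 0 = 0
  -- The gap of two makes the glued edges disjoint; this is what rules out internal vertices and
  -- keeps all degrees at most three.
  att_succ : ∀ i, att i + 2 ≤ att (i + 1)
  att_le : ∀ i, att i ≤ 4 * i
  -- Consecutive numbers `4 * k + 1` and `4 * k + 2` belong to different blocks of new vertices and
  -- do not span an edge.
  att_mod : ∀ i, att i % 4 ≠ 1

/-! ### Neighbours of a vertex: successor, predecessor and third neighbour -/

namespace HexTree

variable (T : HexTree)

theorem att_sep {i j : ℕ} (h : i < j) : T.att i + 2 ≤ T.att j := by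
  induction j, h using Nat.le_induction with
  | base => exact T.att_succ i
  | succ j _ ih => have := T.att_succ j; omega

theorem two_le_att {i : ℕ} (h : 0 < i) : 2 ≤ T.att i := by
  have := T.att_sep h; have := T.att_zero; omega

theorem att_inj {i j : ℕ} (h : T.att i ≤ T.att j + 1) (h' : T.att j ≤ T.att i + 1) : i = j := by
  rcases lt_trichotomy i j with h1 | h1 | h1
  · have := T.att_sep h1; omega
  · exact h1
  · have := T.att_sep h1; omega

/-- `y` follows `x` on the oriented boundary of hexagon `i`. -/
def Follows (i x y : ℕ) : Prop :=
  (x = T.att i ∧ y = 4 * i + 2) ∨ (4 * i + 2 ≤ x ∧ x ≤ 4 * i + 4 ∧ y = x + 1) ∨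
    (x = 4 * i + 5 ∧ y = T.att i + 1) ∨ (x = T.att i + 1 ∧ y = T.att i)

/-- The vertices of hexagon `i`. -/
def hexSet (i : ℕ) : Set ℕ :=
  {x | (4 * i + 2 ≤ x ∧ x ≤ 4 * i + 5) ∨ x = T.att i ∨ x = T.att i + 1}

theorem mem_hexSet {i x : ℕ} :
    x ∈ T.hexSet i ↔ (4 * i + 2 ≤ x ∧ x ≤ 4 * i + 5) ∨ x = T.att i ∨ x = T.att i + 1 := Iff.rfl

theorem lt_of_mem_hexSet {i n x : ℕ} (hi : i < n) (h : x ∈ T.hexSet i) : x < 4 * n + 2 := by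
  have := T.att_le i
  rw [mem_hexSet] at h
  omega

/-- The vertex after `x` on the hexagon that introduces `x`. -/
def nxt (x : ℕ) : ℕ :=
  if x = 0 then 2 else if x = 1 then 0 else if x % 4 = 1 then T.att (x / 4 - 1) + 1 else x + 1

/-- The vertex before `x` on the hexagon that introduces `x`. -/
def prv (x : ℕ) : ℕ :=
  if x = 0 then 1 else if x = 1 then 5 else if x % 4 = 2 then T.att (x / 4) else x - 1

/-- Every vertex is `0`, `1`, or one of the four vertices introduced by some hexagon. -/
theorem vertex_cases (x : ℕ) : x = 0 ∨ x = 1 ∨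
    ∃ i, x = 4 * i + 2 ∨ x = 4 * i + 3 ∨ x = 4 * i + 4 ∨ x = 4 * i + 5 := by
  rcases Nat.lt_or_ge x 2 with h | h
  · omega
  · exact Or.inr (Or.inr ⟨(x - 2) / 4, by omega⟩)

@[simp] theorem nxt_zero : T.nxt 0 = 2 := by simp [nxt]
@[simp] theorem nxt_one : T.nxt 1 = 0 := by simp [nxt]
@[simp] theorem nxt_two (i : ℕ) : T.nxt (4 * i + 2) = 4 * i + 3 := by
  simp [nxt]
@[simp] theorem nxt_three (i : ℕ) : T.nxt (4 * i + 3) = 4 * i + 4 := by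
  simp [nxt]
@[simp] theorem nxt_four (i : ℕ) : T.nxt (4 * i + 4) = 4 * i + 5 := by
  simp [nxt]
@[simp] theorem nxt_five (i : ℕ) : T.nxt (4 * i + 5) = T.att i + 1 := by
  have h : (4 * i + 5) / 4 - 1 = i := by omega
  have h' : (4 * i + 5) % 4 = 1 := by omega
  simp [nxt, h, h']
@[simp] theorem prv_zero : T.prv 0 = 1 := by simp [prv]
@[simp] theorem prv_one : T.prv 1 = 5 := by simp [prv]
@[simp] theorem prv_two (i : ℕ) : T.prv (4 * i + 2) = T.att i := by
  have h : (4 * i + 2) / 4 = i := by omega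
  have h' : (4 * i + 2) % 4 = 2 := by omega
  simp [prv, h, h']
@[simp] theorem prv_three (i : ℕ) : T.prv (4 * i + 3) = 4 * i + 2 := by
  simp [prv]
@[simp] theorem prv_four (i : ℕ) : T.prv (4 * i + 4) = 4 * i + 3 := by
  simp [prv]
@[simp] theorem prv_five (i : ℕ) : T.prv (4 * i + 5) = 4 * i + 4 := by
  simp [prv]

theorem nxt_att {i : ℕ} (h : 0 < i) : T.nxt (T.att i) = T.att i + 1 := by
  have := T.two_le_att h
  have := T.att_mod i
  unfold nxt
  split_ifs <;> omega

theorem prv_att_succ {i : ℕ} (h : 0 < i) : T.prv (T.att i + 1) = T.att i := by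
  have := T.two_le_att h
  have := T.att_mod i
  unfold prv
  rw [if_neg (by omega), if_neg (by omega), if_neg (by omega), Nat.add_sub_cancel]

open Classical in
/-- The neighbour of `x` in the hexagon (with index less than `n`) glued to an edge at `x`;
if there is none, the default value is `prv x`. -/
noncomputable def third (n x : ℕ) : ℕ :=
  if h : ∃ j, 0 < j ∧ j < n ∧ x = T.att j then 4 * h.choose + 2
  else if h : ∃ j, 0 < j ∧ j < n ∧ x = T.att j + 1 then 4 * h.choose + 5
  else T.prv x

open Classical in
/-- The vertex that follows `x` on the outer boundary. -/
noncomputable def outerNext (n x : ℕ) : ℕ :=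
  if ∃ j, 0 < j ∧ j < n ∧ x = T.att j + 1 then T.third n x else T.prv x

theorem third_att {n j : ℕ} (h : 0 < j) (hn : j < n) : T.third n (T.att j) = 4 * j + 2 := by
  have H : ∃ i, 0 < i ∧ i < n ∧ T.att j = T.att i := ⟨j, h, hn, rfl⟩
  have := T.att_inj (i := j) (j := H.choose) (by have := H.choose_spec; omega)
    (by have := H.choose_spec; omega)
  rw [third, dif_pos H, ← this]

theorem third_att_succ {n j : ℕ} (h : 0 < j) (hn : j < n) :
    T.third n (T.att j + 1) = 4 * j + 5 := by
  have H : ∃ i, 0 < i ∧ i < n ∧ T.att j + 1 = T.att i + 1 := ⟨j, h, hn, rfl⟩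
  have H' : ¬ ∃ i, 0 < i ∧ i < n ∧ T.att j + 1 = T.att i := by
    rintro ⟨i, -, -, hi⟩
    have := T.att_inj (i := j) (j := i) (by omega) (by omega)
    subst this
    omega
  have := T.att_inj (i := j) (j := H.choose) (by have := H.choose_spec; omega)
    (by have := H.choose_spec; omega)
  rw [third, dif_neg H', dif_pos H, ← this]

theorem outerNext_att_succ {n j : ℕ} (h : 0 < j) (hn : j < n) :
    T.outerNext n (T.att j + 1) = 4 * j + 5 := by
  rw [outerNext, if_pos ⟨j, h, hn, rfl⟩, T.third_att_succ h hn]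

theorem outerNext_of_forall_ne {n x : ℕ} (h : ∀ j, 0 < j → j < n → x ≠ T.att j + 1) :
    T.outerNext n x = T.prv x := by
  rw [outerNext, if_neg]
  rintro ⟨j, h1, h2, h3⟩
  exact h j h1 h2 h3

theorem third_cases (n x : ℕ) :
    (∃ j, 0 < j ∧ j < n ∧ x = T.att j ∧ T.third n x = 4 * j + 2) ∨
    (∃ j, 0 < j ∧ j < n ∧ x = T.att j + 1 ∧ T.third n x = 4 * j + 5) ∨
    ((∀ j, 0 < j → j < n → x ≠ T.att j ∧ x ≠ T.att j + 1) ∧ T.third n x = T.prv x) := by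
  by_cases h : ∃ j, 0 < j ∧ j < n ∧ x = T.att j
  · obtain ⟨j, h1, h2, rfl⟩ := h
    exact Or.inl ⟨j, h1, h2, rfl, T.third_att h1 h2⟩
  by_cases h' : ∃ j, 0 < j ∧ j < n ∧ x = T.att j + 1
  · obtain ⟨j, h1, h2, rfl⟩ := h'
    exact Or.inr (Or.inl ⟨j, h1, h2, rfl, T.third_att_succ h1 h2⟩)
  · refine Or.inr (Or.inr ⟨fun j h1 h2 => ⟨fun e => h ⟨j, h1, h2, e⟩, fun e => h' ⟨j, h1, h2, e⟩⟩, ?_⟩)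
    rw [third, dif_neg h, dif_neg h']

/-- Adjacency in the union of the first `n` hexagons. -/
def HexAdj (n x y : ℕ) : Prop := ∃ i < n, T.Follows i x y ∨ T.Follows i y x

theorem Follows.ne {T : HexTree} {i x y : ℕ} (h : T.Follows i x y) : x ≠ y := by
  have := T.att_le i
  unfold Follows at h
  omega

theorem HexAdj.symm {T : HexTree} {n x y : ℕ} (h : T.HexAdj n x y) : T.HexAdj n y x := by
  obtain ⟨i, hi, h⟩ := h
  exact ⟨i, hi, h.symm⟩

theorem Follows.left_mem {T : HexTree} {i x y : ℕ} (h : T.Follows i x y) : x ∈ T.hexSet i := by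
  rw [mem_hexSet]; unfold Follows at h; omega

theorem Follows.right_mem {T : HexTree} {i x y : ℕ} (h : T.Follows i x y) : y ∈ T.hexSet i := by
  rw [mem_hexSet]; unfold Follows at h; omega

theorem Follows.eq {T : HexTree} {i x y z : ℕ} (h : T.Follows i x y) (h' : T.Follows i x z) :
    y = z := by
  have := T.att_le i
  unfold Follows at h h'
  omega

theorem hexAdj_nxt {n x : ℕ} (hn : 0 < n) (hx : x < 4 * n + 2) : T.HexAdj n x (T.nxt x) := by
  have h0 := T.att_zero
  rcases vertex_cases x with rfl | rfl | ⟨i, rfl | rfl | rfl | rfl⟩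
  · exact ⟨0, hn, Or.inl (by simp [Follows, h0])⟩
  · exact ⟨0, hn, Or.inl (by simp [Follows, h0])⟩
  all_goals exact ⟨i, by omega, Or.inl (by simp [Follows])⟩

theorem hexAdj_prv {n x : ℕ} (hn : 0 < n) (hx : x < 4 * n + 2) : T.HexAdj n x (T.prv x) := by
  have h0 := T.att_zero
  rcases vertex_cases x with rfl | rfl | ⟨i, rfl | rfl | rfl | rfl⟩
  · exact ⟨0, hn, Or.inr (by simp [Follows, h0])⟩
  · exact ⟨0, hn, Or.inr (by simp [Follows, h0])⟩
  all_goals exact ⟨i, by omega, Or.inr (by simp [Follows])⟩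

theorem hexAdj_third {n x : ℕ} (hn : 0 < n) (hx : x < 4 * n + 2) :
    T.HexAdj n x (T.third n x) := by
  rcases T.third_cases n x with ⟨j, _, h2, h3, h⟩ | ⟨j, _, h2, h3, h⟩ | ⟨_, h⟩
  · exact ⟨j, h2, Or.inl (Or.inl ⟨h3, h⟩)⟩
  · exact ⟨j, h2, Or.inr (Or.inr (Or.inr (Or.inl ⟨h, h3⟩)))⟩
  · rw [h]; exact T.hexAdj_prv hn hx

theorem lt_of_hexAdj {n x y : ℕ} (h : T.HexAdj n x y) : y < 4 * n + 2 := by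
  obtain ⟨i, hi, h | h⟩ := h
  · exact T.lt_of_mem_hexSet hi h.right_mem
  · exact T.lt_of_mem_hexSet hi h.left_mem

/-- The oriented edges of hexagon `i`, in terms of `nxt`, `prv` and `third`. -/
theorem Follows.cases {T : HexTree} {n i x y : ℕ} (hi : i < n) (h : T.Follows i x y) :
    y = T.nxt x ∨ (0 < i ∧ x = T.att i ∧ y = T.third n x) ∨
      (0 < i ∧ x = T.att i + 1 ∧ y = T.prv x) := by
  rcases Nat.eq_zero_or_pos i with rfl | h0
  · left
    have h0 := T.att_zero
    unfold Follows at h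
    rw [h0] at h
    have : x < 6 := by omega
    interval_cases x
    · simp; omega
    · simp; omega
    · have := T.nxt_two 0; simp at this; omega
    · have := T.nxt_three 0; simp at this; omega
    · have := T.nxt_four 0; simp at this; omega
    · have := T.nxt_five 0; simp at this; omega
  · rcases h with ⟨rfl, rfl⟩ | ⟨h1, h2, rfl⟩ | ⟨rfl, rfl⟩ | ⟨rfl, rfl⟩
    · exact Or.inr (Or.inl ⟨h0, rfl, (T.third_att h0 hi).symm⟩)
    · left
      have : x = 4 * i + 2 ∨ x = 4 * i + 3 ∨ x = 4 * i + 4 := by omega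
      rcases this with rfl | rfl | rfl <;> simp
    · simp
    · exact Or.inr (Or.inr ⟨h0, rfl, (T.prv_att_succ h0).symm⟩)

/-- The reversed oriented edges of hexagon `i`, in terms of `nxt`, `prv` and `third`. -/
theorem Follows.symm_cases {T : HexTree} {n i x y : ℕ} (hi : i < n) (h : T.Follows i y x) :
    y = T.prv x ∨ (0 < i ∧ x = T.att i ∧ y = T.nxt x) ∨
      (0 < i ∧ x = T.att i + 1 ∧ y = T.third n x) := by
  rcases Nat.eq_zero_or_pos i with rfl | h0
  · left
    have h0 := T.att_zero
    unfold Follows at h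
    rw [h0] at h
    have : x < 6 := by omega
    interval_cases x
    · simp; omega
    · simp; omega
    · have := T.prv_two 0; simp at this; omega
    · have := T.prv_three 0; simp at this; omega
    · have := T.prv_four 0; simp at this; omega
    · have := T.prv_five 0; simp at this; omega
  · rcases h with ⟨rfl, rfl⟩ | ⟨h1, h2, rfl⟩ | ⟨rfl, rfl⟩ | ⟨rfl, rfl⟩
    · simp
    · left
      have : y = 4 * i + 2 ∨ y = 4 * i + 3 ∨ y = 4 * i + 4 := by omega
      rcases this with rfl | rfl | rfl <;> simp
    · exact Or.inr (Or.inr ⟨h0, rfl, (T.third_att_succ h0 hi).symm⟩)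
    · exact Or.inr (Or.inl ⟨h0, rfl, (T.nxt_att h0).symm⟩)

theorem hexAdj_iff {n x y : ℕ} (hn : 0 < n) (hx : x < 4 * n + 2) :
    T.HexAdj n x y ↔ y = T.nxt x ∨ y = T.prv x ∨ y = T.third n x := by
  constructor
  · rintro ⟨i, hi, h | h⟩
    · rcases h.cases hi with h | h | h <;> tauto
    · rcases h.symm_cases hi with h | h | h <;> tauto
  · rintro (rfl | rfl | rfl)
    · exact T.hexAdj_nxt hn hx
    · exact T.hexAdj_prv hn hx
    · exact T.hexAdj_third hn hx

theorem nxt_ne_prv (x : ℕ) : T.nxt x ≠ T.prv x := by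
  rcases vertex_cases x with rfl | rfl | ⟨i, rfl | rfl | rfl | rfl⟩ <;> simp
  · have := T.att_le i; omega
  · have := T.att_le i; omega

theorem nxt_ne_third (n x : ℕ) : T.nxt x ≠ T.third n x := by
  rcases T.third_cases n x with ⟨j, h1, h2, rfl, h⟩ | ⟨j, h1, h2, rfl, h⟩ | ⟨_, h⟩
  · rw [h, T.nxt_att h1]
    have := T.att_le j
    omega
  · rw [h]
    have h3 := T.att_le j
    have h4 := T.two_le_att h1
    rcases vertex_cases (T.att j + 1) with e | e | ⟨i, e | e | e | e⟩
    · omega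
    · omega
    all_goals
      rw [e]
      simp
      try have := T.att_le i
      omega
  · rw [h]; exact T.nxt_ne_prv x

/-! ### The rotation at a vertex and the tracing of faces, on vertex numbers -/

/-- Cyclic rotation of the neighbours of `x`. -/
noncomputable def rotNat (n x y : ℕ) : ℕ :=
  if y = T.prv x then T.nxt x else if y = T.nxt x then T.third n x else T.prv x

theorem rotNat_prv (n x : ℕ) : T.rotNat n x (T.prv x) = T.nxt x := by simp [rotNat]

theorem rotNat_nxt (n x : ℕ) : T.rotNat n x (T.nxt x) = T.third n x := by
  simp [rotNat, T.nxt_ne_prv]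

theorem rotNat_of_ne {n x y : ℕ} (h : y ≠ T.prv x) (h' : y ≠ T.nxt x) :
    T.rotNat n x y = T.prv x := by
  simp [rotNat, h, h']

theorem hexAdj_rotNat {n x : ℕ} (y : ℕ) (hn : 0 < n) (hx : x < 4 * n + 2) :
    T.HexAdj n x (T.rotNat n x y) := by
  rw [T.hexAdj_iff hn hx]
  unfold rotNat
  split_ifs <;> simp

/-- The rotation runs `prv → nxt → third → prv`. At a vertex of degree two `third` equals `prv` and
the cycle shrinks to a swap, so two steps reach every neighbour in either case. -/
theorem rotNat_orbit {n x y z : ℕ} (hn : 0 < n) (hx : x < 4 * n + 2) (hy : T.HexAdj n x y)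
    (hz : T.HexAdj n x z) :
    z = y ∨ z = T.rotNat n x y ∨ z = T.rotNat n x (T.rotNat n x y) := by
  rw [T.hexAdj_iff hn hx] at hy hz
  have h1 := T.rotNat_prv n x
  have h2 := T.rotNat_nxt n x
  by_cases h : T.third n x = T.prv x
  · rw [h] at hy hz h2
    rcases hy with rfl | rfl | rfl <;> rcases hz with rfl | rfl | rfl <;> simp [h1, h2]
  · have h3 := T.rotNat_of_ne (n := n) h (T.nxt_ne_third n x).symm
    rcases hy with rfl | rfl | rfl <;> rcases hz with rfl | rfl | rfl <;> simp [h1, h2, h3]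

theorem prv_lt {x : ℕ} (hx : 2 ≤ x) : T.prv x < x := by
  rcases vertex_cases x with rfl | rfl | ⟨i, rfl | rfl | rfl | rfl⟩ <;> simp at hx ⊢
  have := T.att_le i
  omega

theorem nxt_prv {x : ℕ} (h : ∀ i, 0 < i → x ≠ 4 * i + 2) : T.nxt (T.prv x) = x := by
  rcases vertex_cases x with rfl | rfl | ⟨i, rfl | rfl | rfl | rfl⟩
  · simp
  · have := T.nxt_five 0
    have := T.att_zero
    simp_all
  · rcases Nat.eq_zero_or_pos i with rfl | h0
    · rw [prv_two, T.att_zero, nxt_zero]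
    · exact absurd rfl (h i h0)
  all_goals simp

theorem third_eq_outerNext {n x : ℕ} (h : ∀ j, 0 < j → j < n → x ≠ T.att j) :
    T.third n x = T.outerNext n x := by
  rcases T.third_cases n x with ⟨j, h1, h2, rfl, _⟩ | ⟨j, h1, h2, rfl, e⟩ | ⟨h', e⟩
  · exact absurd rfl (h j h1 h2)
  · rw [e, T.outerNext_att_succ h1 h2]
  · rw [e, T.outerNext_of_forall_ne fun j h1 h2 => (h' j h1 h2).2]

theorem outerNext_att {n i : ℕ} : T.outerNext n (T.att i) = T.prv (T.att i) := by
  apply T.outerNext_of_forall_ne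
  intro j _ _ h
  have := T.att_inj (i := i) (j := j) (by omega) (by omega)
  subst this
  omega

theorem hexAdj_outerNext {n x : ℕ} (hn : 0 < n) (hx : x < 4 * n + 2) :
    T.HexAdj n x (T.outerNext n x) := by
  unfold outerNext
  split_ifs
  · exact T.hexAdj_third hn hx
  · exact T.hexAdj_prv hn hx

theorem Follows.rotNat {T : HexTree} {n i x y : ℕ} (hi : i < n) (h : T.Follows i x y) :
    T.Follows i y (T.rotNat n y x) := by
  have hle := T.att_le i
  rcases h with ⟨rfl, rfl⟩ | ⟨h1, h2, rfl⟩ | ⟨rfl, rfl⟩ | ⟨rfl, rfl⟩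
  · rw [← T.prv_two i, rotNat_prv, nxt_two]
    unfold Follows; omega
  · have : x = 4 * i + 2 ∨ x = 4 * i + 3 ∨ x = 4 * i + 4 := by omega
    rcases this with rfl | rfl | rfl
    · have := T.rotNat_prv n (4 * i + 3)
      simp only [prv_three, nxt_three] at this
      rw [this]; unfold Follows; omega
    · have := T.rotNat_prv n (4 * i + 4)
      simp only [prv_four, nxt_four] at this
      rw [this]; unfold Follows; omega
    · have := T.rotNat_prv n (4 * i + 5)
      simp only [prv_five, nxt_five] at this
      rw [this]; unfold Follows; omega
  · rcases Nat.eq_zero_or_pos i with rfl | h0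
    · have := T.rotNat_prv n 1
      simp only [prv_one, nxt_one] at this
      simp [T.att_zero, this, Follows]
    · rw [T.rotNat_of_ne, T.prv_att_succ h0]
      · unfold Follows; omega
      · rw [T.prv_att_succ h0]; omega
      · rw [← T.third_att_succ h0 hi]; exact (T.nxt_ne_third _ _).symm
  · rcases Nat.eq_zero_or_pos i with rfl | h0
    · have := T.rotNat_prv n 0
      simp only [prv_zero, nxt_zero] at this
      simp [T.att_zero, this, Follows]
    · rw [← T.nxt_att h0, T.rotNat_nxt, T.third_att h0 hi]
      unfold Follows; omega

/-- This makes the outer darts closed under face tracing. With `y` the outer successor of `x`,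
either `x` is `nxt y`, and the rotation gives `third y`, or `x` is the first new vertex of a hexagon
glued at `y`, and the rotation gives `prv y`. -/
theorem rotNat_outerNext (n x : ℕ) (hx : x < 4 * n + 2) :
    T.rotNat n (T.outerNext n x) x = T.outerNext n (T.outerNext n x) := by
  by_cases h : ∃ j, 0 < j ∧ j < n ∧ x = T.att j + 1
  · obtain ⟨j, h1, h2, rfl⟩ := h
    rw [T.outerNext_att_succ h1 h2]
    have := T.rotNat_nxt n (4 * j + 5)
    rw [nxt_five] at this
    rw [this, T.third_eq_outerNext]
    intro k _ _ hk
    have := T.att_mod k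
    omega
  · have h' : ∀ j, 0 < j → j < n → x ≠ T.att j + 1 := fun j h1 h2 e => h ⟨j, h1, h2, e⟩
    rw [T.outerNext_of_forall_ne h']
    by_cases hx2 : ∃ i, 0 < i ∧ x = 4 * i + 2
    · obtain ⟨i, h0, rfl⟩ := hx2
      have hi : i < n := by omega
      rw [prv_two, outerNext_att, rotNat_of_ne]
      · have := T.prv_lt (T.two_le_att h0)
        have := T.att_le i
        omega
      · rw [T.nxt_att h0]
        have := T.att_le i
        omega
    · have e := T.nxt_prv (x := x) fun i h0 e => hx2 ⟨i, h0, e⟩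
      have e' := T.rotNat_nxt n (T.prv x)
      rw [e] at e'
      rw [e', T.third_eq_outerNext]
      -- If `prv x` were `att k`, its `nxt`, which is `x`, would be `att k + 1`, the case already
      -- treated.
      intro k h1 h2 hk
      apply h' k h1 h2
      rw [← T.nxt_att h1, ← hk, e]

theorem follows_nxt {n x : ℕ} (hn : 0 < n) (hx : x < 4 * n + 2) :
    ∃ i < n, T.Follows i x (T.nxt x) := by
  have h0 := T.att_zero
  rcases vertex_cases x with rfl | rfl | ⟨i, rfl | rfl | rfl | rfl⟩
  · exact ⟨0, hn, by simp [Follows, h0]⟩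
  · exact ⟨0, hn, by simp [Follows, h0]⟩
  all_goals exact ⟨i, by omega, by simp [Follows]⟩

/-- Every oriented edge lies on a hexagon or on the outer boundary. -/
theorem follows_or_eq_outerNext {n x y : ℕ} (hn : 0 < n) (hx : x < 4 * n + 2)
    (h : T.HexAdj n x y) : (∃ i < n, T.Follows i x y) ∨ y = T.outerNext n x := by
  rw [T.hexAdj_iff hn hx] at h
  rcases h with rfl | rfl | rfl
  · exact Or.inl (T.follows_nxt hn hx)
  · by_cases h : ∃ j, 0 < j ∧ j < n ∧ x = T.att j + 1
    · obtain ⟨j, h1, h2, rfl⟩ := h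
      exact Or.inl ⟨j, h2, by rw [T.prv_att_succ h1]; simp [Follows]⟩
    · right
      rw [outerNext, if_neg h]
  · rcases T.third_cases n x with ⟨j, h1, h2, rfl, e⟩ | ⟨j, h1, h2, rfl, e⟩ | ⟨h', e⟩
    · exact Or.inl ⟨j, h2, by rw [e]; simp [Follows]⟩
    · right
      rw [e, T.outerNext_att_succ h1 h2]
    · right
      rw [e, T.outerNext_of_forall_ne fun j h1 h2 => (h' j h1 h2).2]

/-- Keeps the outer face distinct from the hexagonal faces; together with `Follows.index_unique` it
makes the list of faces free of repetitions. -/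
theorem Follows.ne_outerNext {T : HexTree} {n i x y : ℕ} (hi : i < n) (h : T.Follows i x y) :
    y ≠ T.outerNext n x := by
  rcases h.cases hi with rfl | ⟨h0, rfl, rfl⟩ | ⟨h0, rfl, rfl⟩
  · unfold outerNext
    split_ifs
    · exact T.nxt_ne_third n x
    · exact T.nxt_ne_prv x
  · rw [T.third_att h0 hi, outerNext_att]
    have := T.prv_lt (T.two_le_att h0)
    have := T.att_le i
    omega
  · rw [T.prv_att_succ h0, T.outerNext_att_succ h0 hi]
    have := T.att_le i
    omega

theorem Follows.index_unique {T : HexTree} {i j x y : ℕ} (h : T.Follows i x y)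
    (h' : T.Follows j x y) : i = j := by
  have key : ∀ i j, i < j → T.Follows i x y → ¬ T.Follows j x y := by
    intro i j hij h h'
    have := T.att_le i
    have := T.att_le j
    have := T.att_sep hij
    unfold Follows at h h'
    omega
  rcases lt_trichotomy i j with h1 | h1 | h1
  · exact absurd h' (key i j h1 h)
  · exact h1
  · exact absurd h (key j i h1 h')

/-! ### The graph, its rotation system and its faces -/

/-- The union of the first `n` hexagons of a hexagon tree. -/
def graph (n : ℕ) : SimpleGraph (Fin (4 * n + 2)) where
  Adj x y := T.HexAdj n x y
  symm := ⟨fun _ _ h => h.symm⟩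
  loopless := ⟨fun _ ⟨_, _, h⟩ => h.elim (fun h => h.ne rfl) (fun h => h.ne rfl)⟩

theorem graph_adj {n : ℕ} {x y : Fin (4 * n + 2)} : (T.graph n).Adj x y ↔ T.HexAdj n x y := Iff.rfl

/-- The dart with given ends. -/
def mkDart {n x y : ℕ} (h : T.HexAdj n x y) : (T.graph n).Dart :=
  ⟨(⟨x, T.lt_of_hexAdj h.symm⟩, ⟨y, T.lt_of_hexAdj h⟩), h⟩

theorem dart_ext {n : ℕ} {d d' : (T.graph n).Dart} (h : (d.fst : ℕ) = d'.fst)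
    (h' : (d.snd : ℕ) = d'.snd) : d = d' := by
  apply Dart.ext
  exact Prod.ext (Fin.ext h) (Fin.ext h')

/-- The next dart in the rotation around the first end. -/
noncomputable def rotDart {n : ℕ} (hn : 0 < n) (d : (T.graph n).Dart) : (T.graph n).Dart :=
  T.mkDart (T.hexAdj_rotNat d.snd hn d.fst.2)

theorem rotDart_orbit {n : ℕ} (hn : 0 < n) {d d' : (T.graph n).Dart} (h : d.fst = d'.fst) :
    d' = d ∨ d' = T.rotDart hn d ∨ d' = T.rotDart hn (T.rotDart hn d) := by
  have h1 := T.rotNat_orbit hn d.fst.2 d.adj (z := d'.snd) (by rw [h]; exact d'.adj)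
  have h' : (d'.fst : ℕ) = d.fst := by rw [h]
  rcases h1 with h1 | h1 | h1
  · exact Or.inl (T.dart_ext h' h1)
  · exact Or.inr (Or.inl (T.dart_ext h' h1))
  · exact Or.inr (Or.inr (T.dart_ext h' h1))

/-- A dart and its image leave the same vertex, so by `rotDart_orbit` the dart is one of the first
few iterates of its image, hence itself an image. -/
theorem rotDart_bijective {n : ℕ} (hn : 0 < n) : Function.Bijective (T.rotDart (n := n) hn) := by
  classical
  rw [← Finite.surjective_iff_bijective]
  intro d
  have h : (T.rotDart hn d).fst = d.fst := rfl
  rcases T.rotDart_orbit hn h with h | h | h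
  · exact ⟨_, h.symm⟩
  · exact ⟨_, h.symm⟩
  · exact ⟨_, h.symm⟩

/-- The rotation system of the plane drawing of the hexagon tree. -/
noncomputable def rotationSystem {n : ℕ} (hn : 0 < n) : RotationSystem (T.graph n) where
  rot := Equiv.ofBijective (T.rotDart hn) (T.rotDart_bijective hn)
  sameCycle_iff d d' := by
    constructor
    · intro h
      classical
      obtain ⟨k, hk⟩ := h.exists_nat_pow_eq
      rw [← hk]
      clear hk h
      induction k with
      | zero => rfl
      | succ k ih => rw [pow_succ', ih]; rfl
    · intro h
      rcases T.rotDart_orbit hn h with h | h | h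
      · rw [h]
      · exact ⟨1, h.symm⟩
      · exact ⟨2, h.symm⟩

theorem facePerm_fst {n : ℕ} (hn : 0 < n) (d : (T.graph n).Dart) :
    ((T.rotationSystem hn).facePerm d).fst = d.snd := rfl

theorem facePerm_snd {n : ℕ} (hn : 0 < n) (d : (T.graph n).Dart) :
    (((T.rotationSystem hn).facePerm d).snd : ℕ) = T.rotNat n d.snd d.fst := rfl

theorem facePerm_eq_of_follows {n i : ℕ} (hn : 0 < n) (hi : i < n) {d d' : (T.graph n).Dart}
    (h : T.Follows i d.fst d.snd) (h' : T.Follows i d'.fst d'.snd) (e : d'.fst = d.snd) :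
    (T.rotationSystem hn).facePerm d = d' := by
  apply T.dart_ext
  · rw [facePerm_fst, e]
  · rw [facePerm_snd]
    apply (h.rotNat hi).eq
    rwa [← e]

theorem follows_of_sameCycle {n i : ℕ} (hn : 0 < n) (hi : i < n) {d d' : (T.graph n).Dart}
    (h : T.Follows i d.fst d.snd) (hs : (T.rotationSystem hn).facePerm.SameCycle d d') :
    T.Follows i d'.fst d'.snd := by
  classical
  obtain ⟨k, hk⟩ := hs.exists_nat_pow_eq
  rw [← hk]
  clear hk hs
  induction k with
  | zero => exact h
  | succ k ih =>
    rw [pow_succ', Equiv.Perm.mul_apply, facePerm_fst, facePerm_snd]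
    exact ih.rotNat hi

theorem follows_last (i : ℕ) : T.Follows i (T.att i + 1) (T.att i) := by simp [Follows]

/-- A dart on the boundary of hexagon `i`. -/
def innerDart {n i : ℕ} (hi : i < n) : (T.graph n).Dart :=
  T.mkDart ⟨i, hi, Or.inl (T.follows_last i)⟩

theorem sameCycle_of_follows {n i : ℕ} (hn : 0 < n) (hi : i < n) {d : (T.graph n).Dart}
    (h : T.Follows i d.fst d.snd) :
    (T.rotationSystem hn).facePerm.SameCycle (T.innerDart hi) d := by
  have key : ∀ {x y z : ℕ} (h1 : T.Follows i x y) (h2 : T.Follows i y z),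
      (T.rotationSystem hn).facePerm.SameCycle
        (T.mkDart (n := n) ⟨i, hi, Or.inl h1⟩) (T.mkDart (n := n) ⟨i, hi, Or.inl h2⟩) :=
    fun h1 h2 => ⟨1, T.facePerm_eq_of_follows hn hi h1 h2 rfl⟩
  have f0 : T.Follows i (T.att i) (4 * i + 2) := by simp [Follows]
  have f1 : T.Follows i (4 * i + 2) (4 * i + 3) := by simp [Follows]
  have f2 : T.Follows i (4 * i + 3) (4 * i + 4) := by simp [Follows]
  have f3 : T.Follows i (4 * i + 4) (4 * i + 5) := by simp [Follows]
  have f4 : T.Follows i (4 * i + 5) (T.att i + 1) := by simp [Follows]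
  have s0 := key (T.follows_last i) f0
  have s1 := s0.trans (key f0 f1)
  have s2 := s1.trans (key f1 f2)
  have s3 := s2.trans (key f2 f3)
  have s4 := s3.trans (key f3 f4)
  have fin : ∀ {x y : ℕ} (h1 : T.Follows i x y), (d.fst : ℕ) = x →
      T.mkDart (n := n) ⟨i, hi, Or.inl h1⟩ = d := by
    intro x y h1 e
    refine T.dart_ext e.symm ?_
    rw [e] at h
    exact h1.eq h
  have hm := h.left_mem
  rw [mem_hexSet] at hm
  have : (d.fst : ℕ) = T.att i ∨ (d.fst : ℕ) = 4 * i + 2 ∨ (d.fst : ℕ) = 4 * i + 3 ∨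
    (d.fst : ℕ) = 4 * i + 4 ∨ (d.fst : ℕ) = 4 * i + 5 ∨ (d.fst : ℕ) = T.att i + 1 := by omega
  rcases this with e | e | e | e | e | e
  · exact fin f0 e ▸ s0
  · exact fin f1 e ▸ s1
  · exact fin f2 e ▸ s2
  · exact fin f3 e ▸ s3
  · exact fin f4 e ▸ s4
  · exact fin (T.follows_last i) e ▸ Equiv.Perm.SameCycle.refl _ _

/-- The dart of the outer boundary leaving `x`. -/
noncomputable def outerDart {n x : ℕ} (hn : 0 < n) (hx : x < 4 * n + 2) : (T.graph n).Dart :=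
  T.mkDart (T.hexAdj_outerNext hn hx)

theorem outerNext_lt {n x : ℕ} (hn : 0 < n) (hx : x < 4 * n + 2) :
    T.outerNext n x < 4 * n + 2 := T.lt_of_hexAdj (T.hexAdj_outerNext hn hx)

theorem facePerm_outerDart {n x : ℕ} (hn : 0 < n) (hx : x < 4 * n + 2) :
    (T.rotationSystem hn).facePerm (T.outerDart hn hx) =
      T.outerDart hn (T.outerNext_lt hn hx) :=
  T.dart_ext rfl (T.rotNat_outerNext n x hx)

theorem prv_lt_card {n x : ℕ} (hn : 0 < n) (hx : x < 4 * n + 2) :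
    T.prv x < 4 * n + 2 := T.lt_of_hexAdj (T.hexAdj_prv hn hx)

/-- `x` and `y` leave along the same face of the outer boundary. -/
def OuterConn {n : ℕ} (hn : 0 < n) (x y : ℕ) : Prop :=
  ∃ (hx : x < 4 * n + 2) (hy : y < 4 * n + 2),
    (T.rotationSystem hn).facePerm.SameCycle (T.outerDart hn hx) (T.outerDart hn hy)

theorem OuterConn.trans {T : HexTree} {n : ℕ} {hn : 0 < n} {x y z : ℕ}
    (h : T.OuterConn hn x y) (h' : T.OuterConn hn y z) : T.OuterConn hn x z := by
  obtain ⟨hx, hy, h⟩ := h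
  obtain ⟨hy', hz, h'⟩ := h'
  exact ⟨hx, hz, h.trans h'⟩

theorem OuterConn.symm {T : HexTree} {n : ℕ} {hn : 0 < n} {x y : ℕ}
    (h : T.OuterConn hn x y) : T.OuterConn hn y x := by
  obtain ⟨hx, hy, h⟩ := h
  exact ⟨hy, hx, h.symm⟩

theorem outerConn_outerNext {n : ℕ} (hn : 0 < n) {x : ℕ} (hx : x < 4 * n + 2) :
    T.OuterConn hn x (T.outerNext n x) :=
  ⟨hx, T.outerNext_lt hn hx, 1, T.facePerm_outerDart hn hx⟩

/-- Where a hexagon `j` is glued at `x = att j + 1`, the outer walk replaces the step to `att j` by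
a detour through the four new vertices of `j`. These are larger than `x`, whence the downward
induction; further detours between them are covered by the induction hypothesis. -/
theorem outerConn_prv {n : ℕ} (hn : 0 < n) {x : ℕ} (hx : x < 4 * n + 2) :
    T.OuterConn hn x (T.prv x) := by
  induction h : 4 * n + 2 - x using Nat.strong_induction_on generalizing x with
  | _ m ih =>
    subst h
    have h1 := T.outerConn_outerNext hn hx
    by_cases h : ∃ j, 0 < j ∧ j < n ∧ x = T.att j + 1
    · obtain ⟨j, h0, hj, rfl⟩ := h
      have hle := T.att_le j
      rw [T.outerNext_att_succ h0 hj] at h1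
      have h5 := ih (4 * n + 2 - (4 * j + 5)) (by omega) (x := 4 * j + 5) (by omega) rfl
      have h4 := ih (4 * n + 2 - (4 * j + 4)) (by omega) (x := 4 * j + 4) (by omega) rfl
      have h3 := ih (4 * n + 2 - (4 * j + 3)) (by omega) (x := 4 * j + 3) (by omega) rfl
      have h2 := ih (4 * n + 2 - (4 * j + 2)) (by omega) (x := 4 * j + 2) (by omega) rfl
      simp only [prv_two, prv_three, prv_four, prv_five] at h2 h3 h4 h5
      rw [T.prv_att_succ h0]
      exact h1.trans (h5.trans (h4.trans (h3.trans h2)))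
    · rwa [outerNext, if_neg h] at h1

theorem outerConn_zero {n : ℕ} (hn : 0 < n) {x : ℕ} (hx : x < 4 * n + 2) :
    T.OuterConn hn x 0 := by
  induction x using Nat.strong_induction_on with
  | _ x ih =>
    have h := T.outerConn_prv hn hx
    rcases Nat.lt_or_ge x 2 with h2 | h2
    · interval_cases x
      · exact ⟨hx, hx, Equiv.Perm.SameCycle.refl _ _⟩
      · have := T.outerConn_prv hn (x := 0) (by omega)
        rw [prv_zero] at this
        exact this.symm
    · exact h.trans (ih _ (T.prv_lt h2) (T.prv_lt_card hn hx))

theorem sameCycle_outerDart {n x y : ℕ} (hn : 0 < n) (hx : x < 4 * n + 2) (hy : y < 4 * n + 2) :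
    (T.rotationSystem hn).facePerm.SameCycle (T.outerDart hn hx) (T.outerDart hn hy) := by
  obtain ⟨_, _, h⟩ := (T.outerConn_zero hn hx).trans (T.outerConn_zero hn hy).symm
  exact h

/-- The outer boundary is a Hamiltonian cycle. -/
theorem exists_outerNext_iterate {n x y : ℕ} (hn : 0 < n) (hx : x < 4 * n + 2)
    (hy : y < 4 * n + 2) : ∃ k, (T.outerNext n)^[k] x = y := by
  classical
  obtain ⟨k, hk⟩ := (T.sameCycle_outerDart hn hx hy).exists_nat_pow_eq
  refine ⟨k, ?_⟩
  have key : ∀ k, ∃ h : (T.outerNext n)^[k] x < 4 * n + 2,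
      ((T.rotationSystem hn).facePerm ^ k) (T.outerDart hn hx) = T.outerDart hn h := by
    intro k
    induction k with
    | zero => exact ⟨hx, rfl⟩
    | succ k ih =>
      obtain ⟨h, ih⟩ := ih
      rw [pow_succ', Equiv.Perm.mul_apply, ih, facePerm_outerDart]
      simp only [Function.iterate_succ_apply']
      exact ⟨T.outerNext_lt hn h, trivial⟩
  obtain ⟨h, e⟩ := key k
  rw [hk] at e
  exact (congrArg (fun d : (T.graph n).Dart => (d.fst : ℕ)) e).symm

/-- The faces: the outer face and the hexagons. -/
noncomputable def face {n : ℕ} (hn : 0 < n) : Option (Fin n) → (T.rotationSystem hn).Face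
  | none => (T.rotationSystem hn).faceOf (T.outerDart hn (x := 0) (by omega))
  | some i => (T.rotationSystem hn).faceOf (T.innerDart i.2)

theorem faceOf_eq_iff {n : ℕ} (hn : 0 < n) {d d' : (T.graph n).Dart} :
    (T.rotationSystem hn).faceOf d = (T.rotationSystem hn).faceOf d' ↔
      (T.rotationSystem hn).facePerm.SameCycle d d' := Quotient.eq (r := _)

theorem faceOf_eq_face_some {n : ℕ} (hn : 0 < n) {d : (T.graph n).Dart} (i : Fin n) :
    (T.rotationSystem hn).faceOf d = T.face hn (some i) ↔ T.Follows i d.fst d.snd := by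
  unfold face
  rw [faceOf_eq_iff]
  exact ⟨fun h => T.follows_of_sameCycle hn i.2 (T.follows_last i) h.symm,
    fun h => (T.sameCycle_of_follows hn i.2 h).symm⟩

theorem face_bijective {n : ℕ} (hn : 0 < n) : Function.Bijective (T.face hn) := by
  constructor
  · have key : ∀ i : Fin n, T.face hn none ≠ T.face hn (some i) := by
      intro i h
      exact ((T.faceOf_eq_face_some hn i).1 h).ne_outerNext i.2 rfl
    rintro (_ | i) (_ | j) h
    · rfl
    · exact absurd h (key j)
    · exact absurd h.symm (key i)
    · have := (T.faceOf_eq_face_some hn j).1 h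
      rw [Fin.ext (Follows.index_unique (T.follows_last i) this)]
  · intro F
    induction F using Quotient.inductionOn with
    | h d =>
      rcases T.follows_or_eq_outerNext hn d.fst.2 d.adj with ⟨i, hi, h⟩ | h
      · exact ⟨some ⟨i, hi⟩, ((T.faceOf_eq_face_some hn ⟨i, hi⟩).2 h).symm⟩
      · refine ⟨none, ?_⟩
        have : d = T.outerDart hn d.fst.2 := T.dart_ext rfl h
        unfold face
        rw [this]
        exact (T.faceOf_eq_iff hn).2 (T.sameCycle_outerDart hn _ _)

theorem card_face {n : ℕ} (hn : 0 < n) : Nat.card (T.rotationSystem hn).Face = n + 1 := by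
  rw [← Nat.card_congr (Equiv.ofBijective _ (T.face_bijective hn))]
  simp

/-! ### The number of edges and Euler's formula -/

theorem nxt_nxt_ne (x : ℕ) : T.nxt (T.nxt x) ≠ x := by
  intro h
  rcases vertex_cases x with rfl | rfl | ⟨i, rfl | rfl | rfl | rfl⟩
  · have := T.nxt_two 0; simp at h this; omega
  · simp at h
  · simp at h
  · simp at h
  · simp at h; have := T.att_le i; omega
  · rw [nxt_five] at h
    have h1 := T.att_le i
    have h3 := T.att_mod i
    have h4 : T.att i = 0 ∨ 2 ≤ T.att i := by
      rcases Nat.eq_zero_or_pos i with rfl | h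
      · exact Or.inl T.att_zero
      · exact Or.inr (T.two_le_att h)
    rcases vertex_cases (T.att i + 1) with e | e | ⟨k, e | e | e | e⟩
    · omega
    · rw [e, nxt_one] at h; omega
    · omega
    · rw [e, nxt_three] at h; omega
    · rw [e, nxt_four] at h; omega
    · rw [e, nxt_five] at h
      have := T.att_le k
      omega

theorem nxt_lt {n x : ℕ} (hn : 0 < n) (hx : x < 4 * n + 2) :
    T.nxt x < 4 * n + 2 := T.lt_of_hexAdj (T.hexAdj_nxt hn hx)

theorem card_edgeSet {n : ℕ} (hn : 0 < n) : (T.graph n).edgeSet.ncard = 5 * n + 1 := by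
  classical
  -- Each vertex pays for the edge to its `nxt`. The edges left over are those from `att i` to `4 *
  -- i + 2` with `0 < i < n`; hence the shift of `j` by one.
  let f : Fin (4 * n + 2) ⊕ Fin (n - 1) → Sym2 (Fin (4 * n + 2)) := Sum.elim
    (fun x => s(x, ⟨T.nxt x, T.nxt_lt hn x.2⟩))
    (fun j => s(⟨T.att (j + 1), by have := T.att_le (j + 1); omega⟩, ⟨4 * (j + 1) + 2, by omega⟩))
  have hf : Function.Injective f := by
    have key : ∀ (x : Fin (4 * n + 2)) (j : Fin (n - 1)), f (Sum.inl x) ≠ f (Sum.inr j) := by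
      intro x j h
      simp only [f, Sum.elim_inl, Sum.elim_inr, Sym2.eq_iff, Fin.ext_iff] at h
      have := T.att_le (j + 1)
      rcases h with ⟨h1, h2⟩ | ⟨h1, h2⟩
      · rw [h1, T.nxt_att (by omega)] at h2; omega
      · rw [h1, nxt_two] at h2; omega
    rintro (x | j) (y | k) h
    · simp only [f, Sum.elim_inl, Sym2.eq_iff, Fin.ext_iff] at h
      rcases h with ⟨h1, h2⟩ | ⟨h1, h2⟩
      · rw [Fin.ext h1]
      · rw [h1] at h2
        exact absurd h2 (T.nxt_nxt_ne y)
    · exact absurd h (key x k)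
    · exact absurd h.symm (key y j)
    · simp only [f, Sum.elim_inr, Sym2.eq_iff, Fin.ext_iff] at h
      have := T.att_le (j + 1)
      have := T.att_le (k + 1)
      congr 1
      apply Fin.ext
      omega
  have hr : (T.graph n).edgeSet = Set.range f := by
    ext e
    induction e with
    | _ x y =>
      rw [mem_edgeSet, graph_adj]
      constructor
      · rintro ⟨i, hi, h⟩
        have key : ∀ x y : Fin (4 * n + 2), T.Follows i x y → s(x, y) ∈ Set.range f := by
          intro x y h
          rcases h.cases hi with h | ⟨h0, h1, h2⟩ | ⟨h0, h1, h2⟩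
          · exact ⟨Sum.inl x, by simp [f, ← h]⟩
          · refine ⟨Sum.inr ⟨i - 1, by omega⟩, ?_⟩
            have e : i - 1 + 1 = i := by omega
            rw [h1, T.third_att h0 hi] at h2
            simp [f, e, ← h1, ← h2]
          · refine ⟨Sum.inl y, ?_⟩
            rw [h1, T.prv_att_succ h0] at h2
            have h3 : T.nxt y = x := by rw [h2, T.nxt_att h0, h1]
            rw [Sym2.eq_swap]
            simp only [f, Sum.elim_inl, h3]
        rcases h with h | h
        · exact key x y h
        · rw [Sym2.eq_swap]; exact key y x h
      · rintro ⟨x' | j, h⟩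
        · simp only [f, Sum.elim_inl, Sym2.eq_iff] at h
          rcases h with ⟨rfl, rfl⟩ | ⟨rfl, rfl⟩
          · exact T.hexAdj_nxt hn x'.2
          · exact (T.hexAdj_nxt hn x'.2).symm
        · simp only [f, Sum.elim_inr, Sym2.eq_iff] at h
          rcases h with ⟨rfl, rfl⟩ | ⟨rfl, rfl⟩
          · exact ⟨j + 1, by omega, Or.inl (by simp [Follows])⟩
          · exact ⟨j + 1, by omega, Or.inr (by simp [Follows])⟩
  rw [hr, ← Set.image_univ, Set.ncard_image_of_injective _ hf, Set.ncard_univ]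
  simp
  omega

/-- The plane drawing of the hexagon tree. -/
noncomputable def planeEmbedding {n : ℕ} (hn : 0 < n) : PlaneEmbedding (T.graph n) where
  toRotationSystem := T.rotationSystem hn
  spherical := by
    unfold RotationSystem.IsSpherical
    rw [card_face, card_edgeSet T hn, Nat.card_fin]
    push_cast
    ring
  outer := T.face hn none

/-! ### Two-connectedness from the Hamiltonian outer cycle -/

theorem isTwoConnected {n : ℕ} (hn : 0 < n) : (T.graph n).IsTwoConnected := by
  have h2 : ∀ v : Fin (4 * n + 2), ((T.graph n).induce {v}ᶜ).Connected := by
    intro v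
    classical
    let w : Fin (4 * n + 2) := ⟨T.outerNext n v, T.outerNext_lt hn v.2⟩
    have hw : (T.graph n).Adj v w := T.hexAdj_outerNext hn v.2
    have key : ∀ k (hk : (T.outerNext n)^[k] w < 4 * n + 2),
        (∀ l ≤ k, (T.outerNext n)^[l] w ≠ v) → ∀ h : _,
        ((T.graph n).induce {v}ᶜ).Reachable ⟨w, hw.ne.symm⟩ ⟨⟨(T.outerNext n)^[k] w, hk⟩, h⟩ := by
      intro k
      induction k with
      | zero => intro _ _ _; exact Reachable.refl _
      | succ k ih =>
        intro hk hl h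
        have hk' : (T.outerNext n)^[k] w < 4 * n + 2 := by
          clear ih hk hl h
          induction k with
          | zero => exact w.2
          | succ k ih => rw [Function.iterate_succ_apply']; exact T.outerNext_lt hn ih
        refine (ih hk' (fun l hl' => hl l (by omega)) ?_).trans (Adj.reachable ?_)
        · intro e
          exact hl k (by omega) (congrArg Fin.val e)
        · simp only [comap_adj, Function.Embedding.subtype_apply, graph_adj,
            Function.iterate_succ_apply']
          exact T.hexAdj_outerNext hn hk'
    rw [connected_iff_exists_forall_reachable]
    refine ⟨⟨w, hw.ne.symm⟩, ?_⟩
    rintro ⟨x, hx⟩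
    have hex : ∃ k, (T.outerNext n)^[k] w = x := T.exists_outerNext_iterate hn w.2 x.2
    have hmin := Nat.find_spec hex
    have := key (Nat.find hex) (by rw [hmin]; exact x.2) ?_ (by
      intro e
      exact hx (by rw [← e]; exact Fin.ext hmin.symm))
    · convert this using 3
      exact hmin.symm
    · intro l hl e
      rcases hl.eq_or_lt with rfl | hl
      · rw [hmin] at e
        exact hx (Fin.ext e)
      -- A walk that met `v` before reaching `x` would return to `w` one step later; dropping that
      -- loop gives an earlier arrival at `x`, against minimality.
      · obtain ⟨m, hm⟩ : ∃ m, Nat.find hex = m + (l + 1) := ⟨Nat.find hex - (l + 1), by omega⟩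
        rw [hm, Function.iterate_add_apply, Function.iterate_succ_apply', e] at hmin
        exact Nat.find_min hex (m := m) (by omega) hmin
  refine ⟨by simp; omega, ?_, h2⟩
  rw [connected_iff_exists_forall_reachable]
  refine ⟨⟨0, by omega⟩, ?_⟩
  have key : ∀ x (hx : x < 4 * n + 2), (T.graph n).Reachable ⟨0, by omega⟩ ⟨x, hx⟩ := by
    intro x
    induction x using Nat.strong_induction_on with
    | _ x ih =>
      intro hx
      rcases Nat.lt_or_ge x 2 with h2 | h2
      · interval_cases x
        · exact Reachable.refl _
        · refine Adj.reachable ?_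
          rw [graph_adj]
          have := T.hexAdj_prv hn (x := 0) (by omega)
          rwa [prv_zero] at this
      · refine (ih _ (T.prv_lt h2) (T.prv_lt_card hn hx)).trans (Adj.reachable ?_)
        exact (T.hexAdj_prv hn hx).symm
  exact fun x => key x x.2

end HexTree

/-! ### Classification of the hexagons of the graph -/

section Hexagon

variable {V : Type*} {G : SimpleGraph V} {H : G.Subgraph}

theorem IsHexagon.ncard_verts (h : IsHexagon H) : H.verts.ncard = 6 := by
  obtain ⟨e⟩ := h
  rw [← Nat.card_coe_set_eq, Nat.card_congr e.toEquiv, Nat.card_fin]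

theorem IsHexagon.exists_neighbors (h : IsHexagon H) {x : V} (hx : x ∈ H.verts) :
    ∃ y z, y ≠ z ∧ ∀ w, H.Adj x w ↔ w = y ∨ w = z := by
  obtain ⟨e⟩ := h
  refine ⟨e.symm (e ⟨x, hx⟩ + 1), e.symm (e ⟨x, hx⟩ - 1), ?_, ?_⟩
  · intro h
    have h' := e.symm.injective (Subtype.ext h)
    generalize e ⟨x, hx⟩ = k at h'
    revert h' k
    decide
  · intro w
    have key : ∀ hw : w ∈ H.verts, H.Adj x w ↔ (cycleGraph 6).Adj (e ⟨x, hx⟩) (e ⟨w, hw⟩) :=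
      fun hw => (e.map_adj_iff (v := ⟨x, hx⟩) (w := ⟨w, hw⟩)).symm
    have hc : ∀ k l : Fin 6, (cycleGraph 6).Adj k l ↔ l = k + 1 ∨ l = k - 1 := by
      intro k l
      rw [cycleGraph_adj]
      revert k l
      decide
    constructor
    · intro h
      have := (key h.snd_mem).1 h
      rw [hc] at this
      rcases this with h1 | h1
      · left; rw [← h1]; simp
      · right; rw [← h1]; simp
    · rintro (rfl | rfl)
      · rw [key (Subtype.coe_prop _), hc]; simp
      · rw [key (Subtype.coe_prop _), hc]; simp

end Hexagon

namespace HexTree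

variable (T : HexTree)

/-- The constructed hexagons have no chords, so each may be taken as an induced subgraph. -/
theorem Follows.of_mem_hexSet {T : HexTree} {i j x y : ℕ} (h : T.Follows j x y)
    (hx : x ∈ T.hexSet i) (hy : y ∈ T.hexSet i) : T.Follows i x y ∨ T.Follows i y x := by
  rw [mem_hexSet] at hx hy
  have h1 := T.att_le i
  have h2 := T.att_le j
  rcases lt_trichotomy i j with hij | rfl | hij
  · have h3 := T.att_sep hij
    have h4 := T.att_mod j
    unfold Follows at h ⊢
    right
    omega
  · exact Or.inl h
  · have h3 := T.att_sep hij
    have hxj := h.left_mem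
    have hyj := h.right_mem
    have hne := h.ne
    rw [mem_hexSet] at hxj hyj
    have h5 : x = T.att i ∨ x = T.att i + 1 := by omega
    have h6 : y = T.att i ∨ y = T.att i + 1 := by omega
    rcases h5 with rfl | rfl <;> rcases h6 with rfl | rfl
    · exact absurd rfl hne
    · exact Or.inr (T.follows_last i)
    · exact Or.inl (T.follows_last i)
    · exact absurd rfl hne

/-- The hexagons of the graph of a hexagon tree. -/
def hexSub (n i : ℕ) : (T.graph n).Subgraph :=
  (⊤ : (T.graph n).Subgraph).induce {x | (x : ℕ) ∈ T.hexSet i}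

theorem mem_hexSub_verts {n i : ℕ} {x : Fin (4 * n + 2)} :
    x ∈ (T.hexSub n i).verts ↔ (x : ℕ) ∈ T.hexSet i := Iff.rfl

theorem hexSub_adj {n i : ℕ} (hi : i < n) {x y : Fin (4 * n + 2)} :
    (T.hexSub n i).Adj x y ↔ T.Follows i x y ∨ T.Follows i y x := by
  simp only [hexSub, Subgraph.induce_adj, Subgraph.top_adj, Set.mem_ofPred_eq, graph_adj]
  constructor
  · rintro ⟨hx, hy, j, _, h | h⟩
    · exact h.of_mem_hexSet hx hy
    · exact (h.of_mem_hexSet hy hx).symm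
  · rintro (h | h)
    · exact ⟨h.left_mem, h.right_mem, i, hi, Or.inl h⟩
    · exact ⟨h.right_mem, h.left_mem, i, hi, Or.inr h⟩

/-- The vertices of hexagon `i` in cyclic order. -/
def hexVert (i : ℕ) : Fin 6 → ℕ :=
  ![T.att i, 4 * i + 2, 4 * i + 3, 4 * i + 4, 4 * i + 5, T.att i + 1]

theorem hexVert_mem (i : ℕ) (k : Fin 6) : T.hexVert i k ∈ T.hexSet i := by
  rw [mem_hexSet]
  fin_cases k <;> simp [hexVert]

theorem hexVert_injective (i : ℕ) : Function.Injective (T.hexVert i) := by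
  have := T.att_le i
  intro k l h
  fin_cases k <;> fin_cases l <;> simp [hexVert] at h ⊢ <;> omega

theorem exists_hexVert {i x : ℕ} (h : x ∈ T.hexSet i) : ∃ k, T.hexVert i k = x := by
  rw [mem_hexSet] at h
  have : x = T.att i ∨ x = 4 * i + 2 ∨ x = 4 * i + 3 ∨ x = 4 * i + 4 ∨ x = 4 * i + 5 ∨
    x = T.att i + 1 := by omega
  rcases this with rfl | rfl | rfl | rfl | rfl | rfl
  · exact ⟨0, rfl⟩
  · exact ⟨1, rfl⟩
  · exact ⟨2, rfl⟩
  · exact ⟨3, rfl⟩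
  · exact ⟨4, rfl⟩
  · exact ⟨5, rfl⟩

theorem follows_hexVert (i : ℕ) (k : Fin 6) :
    T.Follows i (T.hexVert i k) (T.hexVert i (k + 1)) := by
  fin_cases k <;> simp [hexVert, Follows]

theorem follows_hexVert_iff (i : ℕ) (k l : Fin 6) :
    T.Follows i (T.hexVert i k) (T.hexVert i l) ↔ l = k + 1 := by
  constructor
  · intro h
    exact T.hexVert_injective i (h.eq (T.follows_hexVert i k))
  · rintro rfl
    exact T.follows_hexVert i k

theorem isHexagon_hexSub {n i : ℕ} (hi : i < n) : IsHexagon (T.hexSub n i) := by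
  let f : Fin 6 → (T.hexSub n i).verts := fun k =>
    ⟨⟨T.hexVert i k, T.lt_of_mem_hexSet hi (T.hexVert_mem i k)⟩, T.hexVert_mem i k⟩
  have hf : Function.Bijective f := by
    constructor
    · intro k l h
      exact T.hexVert_injective i (congrArg (fun z => (z.1 : ℕ)) h)
    · rintro ⟨x, hx⟩
      obtain ⟨k, hk⟩ := T.exists_hexVert hx
      exact ⟨k, Subtype.ext (Fin.ext hk)⟩
  refine ⟨RelIso.symm ⟨Equiv.ofBijective f hf, ?_⟩⟩
  intro k l
  rw [cycleGraph_adj]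
  simp only [Subgraph.coe_adj, T.hexSub_adj hi]
  change T.Follows i (T.hexVert i k) (T.hexVert i l) ∨
    T.Follows i (T.hexVert i l) (T.hexVert i k) ↔ _
  rw [follows_hexVert_iff, follows_hexVert_iff]
  revert k l
  decide

/-- A third neighbour of a vertex `x ≥ 4 * i + 2` other than `prv x` lies in a hexagon glued later,
so it is at least `4 * i + 6` and outside `H`. The two neighbours of `x` in `H` can then only be
`nxt x` and `prv x`. -/
theorem nxt_prv_mem_of_isHexagon {n i : ℕ} (hn : 0 < n) {H : (T.graph n).Subgraph}
    (hH : IsHexagon H) (hlt : ∀ y ∈ H.verts, (y : ℕ) < 4 * i + 6) {x : ℕ}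
    (hx : x ∈ Fin.val '' H.verts) (hxi : 4 * i + 2 ≤ x) :
    T.nxt x ∈ Fin.val '' H.verts ∧ T.prv x ∈ Fin.val '' H.verts := by
  obtain ⟨x, hx, rfl⟩ := hx
  obtain ⟨y, z, hyz, h⟩ := hH.exists_neighbors hx
  have hy : H.Adj x y := (h y).2 (Or.inl rfl)
  have hz : H.Adj x z := (h z).2 (Or.inr rfl)
  have key : ∀ w : Fin (4 * n + 2), H.Adj x w → (w : ℕ) = T.nxt x ∨ (w : ℕ) = T.prv x := by
    intro w hw
    have h1 := hlt w hw.snd_mem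
    rcases (T.hexAdj_iff hn x.2).1 hw.adj_sub with e | e | e
    · exact Or.inl e
    · exact Or.inr e
    · rcases T.third_cases n x with ⟨j, h2, h3, h4, h5⟩ | ⟨j, h2, h3, h4, h5⟩ | ⟨_, h5⟩
      · have := T.att_le j; omega
      · have := T.att_le j; omega
      · exact Or.inr (e.trans h5)
  have hyz' : (y : ℕ) ≠ z := fun e => hyz (Fin.ext e)
  rcases key y hy with e1 | e1 <;> rcases key z hz with e2 | e2
  · omega
  · exact ⟨⟨y, hy.snd_mem, e1⟩, ⟨z, hz.snd_mem, e2⟩⟩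
  · exact ⟨⟨z, hz.snd_mem, e2⟩, ⟨y, hy.snd_mem, e1⟩⟩
  · omega

theorem exists_hexSet_subset {n : ℕ} (hn : 0 < n) {H : (T.graph n).Subgraph}
    (hH : IsHexagon H) : ∃ i < n, T.hexSet i ⊆ Fin.val '' H.verts := by
  have hne : H.verts.Nonempty := by
    rw [← Set.ncard_pos (Set.toFinite _), hH.ncard_verts]; omega
  obtain ⟨m, hm, hmax⟩ := Set.exists_max_image H.verts (fun x => (x : ℕ)) (Set.toFinite _) hne
  have hm2 : 2 ≤ (m : ℕ) := by
    by_contra hlt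
    have hsub : Fin.val '' H.verts ⊆ ({0, 1} : Finset ℕ) := by
      rintro _ ⟨x, hx, rfl⟩
      have := hmax x hx
      rw [Finset.mem_coe, Finset.mem_insert, Finset.mem_singleton]
      omega
    have := Set.ncard_le_ncard hsub (Set.toFinite _)
    rw [Set.ncard_image_of_injective _ Fin.val_injective, hH.ncard_verts,
      Set.ncard_coe_finset] at this
    simp at this
  obtain ⟨i, hi⟩ : ∃ i, (m : ℕ) = 4 * i + 2 ∨ (m : ℕ) = 4 * i + 3 ∨ (m : ℕ) = 4 * i + 4 ∨
      (m : ℕ) = 4 * i + 5 := ⟨(m - 2) / 4, by omega⟩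
  have hlt : ∀ y ∈ H.verts, (y : ℕ) < 4 * i + 6 := by
    intro y hy
    have := hmax y hy
    omega
  have hmem : (m : ℕ) ∈ Fin.val '' H.verts := ⟨m, hm, rfl⟩
  have N : ∀ x, x ∈ Fin.val '' H.verts → 4 * i + 2 ≤ x → T.nxt x ∈ Fin.val '' H.verts :=
    fun x hx h => (T.nxt_prv_mem_of_isHexagon hn hH hlt hx h).1
  have P : ∀ x, x ∈ Fin.val '' H.verts → 4 * i + 2 ≤ x → T.prv x ∈ Fin.val '' H.verts :=
    fun x hx h => (T.nxt_prv_mem_of_isHexagon hn hH hlt hx h).2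
  have p5 := P (4 * i + 5)
  have p4 := P (4 * i + 4)
  have p3 := P (4 * i + 3)
  have p2 := P (4 * i + 2)
  have n5 := N (4 * i + 5)
  have n4 := N (4 * i + 4)
  have n3 := N (4 * i + 3)
  have n2 := N (4 * i + 2)
  simp only [nxt_two, nxt_three, nxt_four, nxt_five, prv_two, prv_three, prv_four,
    prv_five] at p2 p3 p4 p5 n2 n3 n4 n5
  have h2 : 4 * i + 2 ∈ Fin.val '' H.verts := by
    rcases hi with e | e | e | e <;> rw [e] at hmem
    · exact hmem
    · exact p3 hmem (by omega)
    · exact p3 (p4 hmem (by omega)) (by omega)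
    · exact p3 (p4 (p5 hmem (by omega)) (by omega)) (by omega)
  have h3 := n2 h2 (by omega)
  have h4 := n3 h3 (by omega)
  have h5 := n4 h4 (by omega)
  refine ⟨i, by have := m.2; omega, ?_⟩
  intro x hx
  rw [mem_hexSet] at hx
  have : x = T.att i ∨ x = 4 * i + 2 ∨ x = 4 * i + 3 ∨ x = 4 * i + 4 ∨ x = 4 * i + 5 ∨
    x = T.att i + 1 := by omega
  rcases this with rfl | rfl | rfl | rfl | rfl | rfl
  · exact p2 h2 (by omega)
  · exact h2
  · exact h3
  · exact h4
  · exact h5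
  · exact n5 h5 (by omega)

theorem isHexagon_iff {n : ℕ} (hn : 0 < n) {H : (T.graph n).Subgraph} :
    IsHexagon H ↔ ∃ i < n, H = T.hexSub n i := by
  constructor
  · intro hH
    obtain ⟨i, hi, hsub⟩ := T.exists_hexSet_subset hn hH
    have hK := T.isHexagon_hexSub hi
    have hv : H.verts = (T.hexSub n i).verts := by
      refine (Set.eq_of_subset_of_ncard_le ?_ ?_ (Set.toFinite _)).symm
      · intro x hx
        obtain ⟨y, hy, e⟩ := hsub hx
        rwa [← Fin.ext e]
      · rw [hK.ncard_verts, hH.ncard_verts]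
    -- On equal vertex sets `H` lies in the induced hexagon; as both are 2-regular, they have the
    -- same edges.
    have hle : ∀ x y, H.Adj x y → (T.hexSub n i).Adj x y := by
      intro x y h
      have hx := h.fst_mem
      have hy := h.snd_mem
      rw [hv] at hx hy
      exact ⟨hx, hy, h.adj_sub⟩
    refine ⟨i, hi, Subgraph.ext hv ?_⟩
    funext x y
    refine propext ⟨hle x y, fun h => ?_⟩
    have hx := h.fst_mem
    obtain ⟨y1, z1, _, h2⟩ := hK.exists_neighbors hx
    rw [← hv] at hx
    obtain ⟨y2, z2, hne, h3⟩ := hH.exists_neighbors hx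
    have a := hle x y2 ((h3 _).2 (Or.inl rfl))
    have b := hle x z2 ((h3 _).2 (Or.inr rfl))
    rw [h2] at a b h
    rw [h3]
    grind
  · rintro ⟨i, hi, rfl⟩
    exact T.isHexagon_hexSub hi

/-! ### Intersections of hexagons; the graph is a catacondensed benzenoid -/

theorem hexSet_inter {i j x : ℕ} (hij : i < j) (hi : x ∈ T.hexSet i) (hj : x ∈ T.hexSet j) :
    (x = T.att j ∨ x = T.att j + 1) ∧ T.att j ∈ T.hexSet i ∧ T.att j + 1 ∈ T.hexSet i := by
  simp only [mem_hexSet] at *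
  have h1 := T.att_le i
  have h2 := T.att_le j
  have h3 := T.att_sep hij
  have h4 := T.att_mod j
  omega

theorem hexSet_injective : Function.Injective T.hexSet := by
  have key : ∀ i j, i < j → T.hexSet i ≠ T.hexSet j := by
    intro i j hij h
    have : 4 * j + 5 ∈ T.hexSet i := by rw [h, mem_hexSet]; omega
    rw [mem_hexSet] at this
    have := T.att_le i
    omega
  intro i j h
  rcases lt_trichotomy i j with h1 | h1 | h1
  · exact absurd h (key i j h1)
  · exact h1
  · exact absurd h.symm (key j i h1)

theorem hexSub_inj {n i j : ℕ} (hi : i < n) (hj : j < n) (h : T.hexSub n i = T.hexSub n j) :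
    i = j := by
  apply T.hexSet_injective
  ext x
  have hv := congrArg Subgraph.verts h
  constructor
  · intro hx
    have : (⟨x, T.lt_of_mem_hexSet hi hx⟩ : Fin (4 * n + 2)) ∈ (T.hexSub n i).verts := hx
    rw [hv] at this
    exact this
  · intro hx
    have : (⟨x, T.lt_of_mem_hexSet hj hx⟩ : Fin (4 * n + 2)) ∈ (T.hexSub n j).verts := hx
    rw [← hv] at this
    exact this

theorem boundary_face {n : ℕ} (hn : 0 < n) (i : Fin n) :
    (T.rotationSystem hn).boundary (T.face hn (some i)) = T.hexSub n i := by
  have hadj : ∀ x y, ((T.rotationSystem hn).boundary (T.face hn (some i))).Adj x y ↔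
      (T.hexSub n i).Adj x y := by
    intro x y
    simp only [RotationSystem.boundary, Subgraph.iSup_adj, T.hexSub_adj i.2]
    constructor
    · rintro ⟨⟨d, hd⟩, h⟩
      rw [faceOf_eq_face_some] at hd
      rw [subgraphOfAdj_adj, Sym2.eq_iff] at h
      rcases h with ⟨rfl, rfl⟩ | ⟨rfl, rfl⟩
      · exact Or.inl hd
      · exact Or.inr hd
    · rintro (h | h)
      · exact ⟨⟨T.mkDart ⟨i, i.2, Or.inl h⟩, (T.faceOf_eq_face_some hn i).2 h⟩,
          by rw [subgraphOfAdj_adj]; rfl⟩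
      · exact ⟨⟨T.mkDart ⟨i, i.2, Or.inl h⟩, (T.faceOf_eq_face_some hn i).2 h⟩,
          by rw [subgraphOfAdj_adj]; exact Sym2.eq_swap⟩
  refine Subgraph.ext ?_ (by funext x y; exact propext (hadj x y))
  ext x
  constructor
  · intro hx
    simp only [RotationSystem.boundary, Subgraph.verts_iSup, Set.mem_iUnion] at hx
    obtain ⟨⟨d, hd⟩, h⟩ := hx
    rw [faceOf_eq_face_some] at hd
    simp only [subgraphOfAdj_verts, Set.mem_insert_iff, Set.mem_singleton_iff] at h
    rcases h with rfl | rfl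
    · exact hd.left_mem
    · exact hd.right_mem
  · intro hx
    obtain ⟨y, z, _, h⟩ := (T.isHexagon_hexSub i.2).exists_neighbors hx
    exact ((hadj x y).2 ((h y).2 (Or.inl rfl))).fst_mem

theorem hexSub_inf_hexSub {n i j : ℕ} (hij : i < j) (hj : j < n) :
    Disjoint (T.hexSub n i).verts (T.hexSub n j).verts ∨
      ∃ (u v : Fin (4 * n + 2)) (h : (T.graph n).Adj u v),
        T.hexSub n i ⊓ T.hexSub n j = (T.graph n).subgraphOfAdj h := by
  by_cases hd : Disjoint (T.hexSub n i).verts (T.hexSub n j).verts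
  · exact Or.inl hd
  right
  obtain ⟨x, hxi, hxj⟩ := Set.not_disjoint_iff.1 hd
  obtain ⟨_, hu, hv⟩ := T.hexSet_inter hij hxi hxj
  have hu' : T.att j ∈ T.hexSet j := by simp [mem_hexSet]
  have hv' : T.att j + 1 ∈ T.hexSet j := by simp [mem_hexSet]
  have hA : T.HexAdj n (T.att j) (T.att j + 1) := ⟨j, hj, Or.inr (T.follows_last j)⟩
  let u : Fin (4 * n + 2) := ⟨T.att j, T.lt_of_mem_hexSet hj hu'⟩
  let v : Fin (4 * n + 2) := ⟨T.att j + 1, T.lt_of_mem_hexSet hj hv'⟩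
  have huv : (T.graph n).Adj u v := hA
  have hmem : ∀ y : Fin (4 * n + 2), (y : ℕ) ∈ T.hexSet i → (y : ℕ) ∈ T.hexSet j →
      y = u ∨ y = v := by
    intro y h1 h2
    rcases (T.hexSet_inter hij h1 h2).1 with e | e
    · exact Or.inl (Fin.ext e)
    · exact Or.inr (Fin.ext e)
  refine ⟨u, v, huv, Subgraph.ext ?_ ?_⟩
  · ext y
    simp only [Subgraph.verts_inf, Set.mem_inter_iff, mem_hexSub_verts, subgraphOfAdj_verts,
      Set.mem_insert_iff, Set.mem_singleton_iff]
    constructor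
    · rintro ⟨h1, h2⟩
      exact hmem y h1 h2
    · rintro (rfl | rfl)
      · exact ⟨hu, hu'⟩
      · exact ⟨hv, hv'⟩
  · funext y z
    apply propext
    rw [Subgraph.inf_adj, subgraphOfAdj_adj]
    constructor
    · rintro ⟨h1, h2⟩
      have hne := h1.ne
      rcases hmem y h1.fst_mem h2.fst_mem with rfl | rfl <;>
        rcases hmem z h1.snd_mem h2.snd_mem with rfl | rfl
      · exact absurd rfl hne
      · rfl
      · exact Sym2.eq_swap
      · exact absurd rfl hne
    · intro h
      rw [Sym2.eq_iff] at h
      rcases h with ⟨rfl, rfl⟩ | ⟨rfl, rfl⟩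
      · exact ⟨⟨hu, hv, huv⟩, ⟨hu', hv', huv⟩⟩
      · exact ⟨⟨hv, hu, huv.symm⟩, ⟨hv', hu', huv.symm⟩⟩

/-- A vertex common to hexagons `a < b < c` would lie on the glued edges of both `b` and `c`, which
are disjoint. -/
theorem not_mem_three_hexSets {i j k x : ℕ} (hij : i ≠ j) (hik : i ≠ k) (hjk : j ≠ k)
    (hi : x ∈ T.hexSet i) (hj : x ∈ T.hexSet j) (hk : x ∈ T.hexSet k) : False := by
  have key : ∀ a b c, a < b → b < c → x ∈ T.hexSet a → x ∈ T.hexSet b → x ∈ T.hexSet c →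
      False := by
    intro a b c hab hbc ha hb hc
    have h1 := (T.hexSet_inter hab ha hb).1
    have h2 := (T.hexSet_inter (hab.trans hbc) ha hc).1
    have h3 := T.att_sep hbc
    omega
  rcases hij.lt_or_gt with h1 | h1 <;> rcases hik.lt_or_gt with h2 | h2 <;>
    rcases hjk.lt_or_gt with h3 | h3
  · exact key i j k h1 h3 hi hj hk
  · exact key i k j h2 h3 hi hk hj
  · omega
  · exact key k i j h2 h1 hk hi hj
  · exact key j i k h1 h2 hj hi hk
  · omega
  · exact key j k i h3 h2 hj hk hi
  · exact key k j i h3 h1 hk hj hi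

theorem not_isInternalVertex {n : ℕ} (hn : 0 < n) (v : Fin (4 * n + 2)) :
    ¬ (T.graph n).IsInternalVertex v := by
  rintro ⟨H₁, H₂, H₃, h1, h2, h3, h12, h13, h23, m1, m2, m3⟩
  rw [T.isHexagon_iff hn] at h1 h2 h3
  obtain ⟨i, _, rfl⟩ := h1
  obtain ⟨j, _, rfl⟩ := h2
  obtain ⟨k, _, rfl⟩ := h3
  exact T.not_mem_three_hexSets (fun e => h12 (by rw [e])) (fun e => h13 (by rw [e]))
    (fun e => h23 (by rw [e])) m1 m2 m3

theorem isCatacondensedBenzenoid {n : ℕ} (hn : 0 < n) :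
    (T.graph n).IsCatacondensedBenzenoid := by
  refine ⟨⟨inferInstance, T.isTwoConnected hn, ⟨T.planeEmbedding hn, ?_, ?_⟩, ?_, ?_⟩,
    T.not_isInternalVertex hn⟩
  · intro F hF
    obtain ⟨o, rfl⟩ := (T.face_bijective hn).2 F
    cases o with
    | none => exact absurd rfl hF
    | some i =>
      change IsHexagon ((T.rotationSystem hn).boundary _)
      rw [T.boundary_face hn]
      exact T.isHexagon_hexSub i.2
  · intro H hH
    obtain ⟨i, hi, rfl⟩ := (T.isHexagon_iff hn).1 hH
    refine ⟨T.face hn (some ⟨i, hi⟩), ?_, T.boundary_face hn ⟨i, hi⟩⟩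
    intro h
    simpa using (T.face_bijective hn).1 (a₂ := none) h
  · intro H₁ H₂ h1 h2 hne
    obtain ⟨i, hi, rfl⟩ := (T.isHexagon_iff hn).1 h1
    obtain ⟨j, hj, rfl⟩ := (T.isHexagon_iff hn).1 h2
    have hij : i ≠ j := fun e => hne (by rw [e])
    rcases hij.lt_or_gt with h | h
    · exact T.hexSub_inf_hexSub h hj
    · rw [disjoint_comm, inf_comm]
      exact T.hexSub_inf_hexSub h hi
  · intro H₁ H₂ H₃ h1 h2 h3 h12 h13 h23
    rw [Set.eq_empty_iff_forall_notMem]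
    intro e
    induction e with
    | _ x y =>
      rintro ⟨⟨a, b⟩, c⟩
      rw [Subgraph.mem_edgeSet] at a b c
      exact T.not_isInternalVertex hn x
        ⟨H₁, H₂, H₃, h1, h2, h3, h12, h13, h23, a.fst_mem, b.fst_mem, c.fst_mem⟩

theorem numHexagons_graph {n : ℕ} (hn : 0 < n) : (T.graph n).numHexagons = n := by
  have : {H : (T.graph n).Subgraph | IsHexagon H} = Set.range fun i : Fin n => T.hexSub n i := by
    ext H
    rw [Set.mem_ofPred_eq, T.isHexagon_iff hn]
    constructor
    · rintro ⟨i, hi, rfl⟩; exact ⟨⟨i, hi⟩, rfl⟩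
    · rintro ⟨i, rfl⟩; exact ⟨i, i.2, rfl⟩
  rw [numHexagons, this, ← Set.image_univ, Set.ncard_image_of_injective, Set.ncard_univ,
    Nat.card_fin]
  intro i j h
  exact Fin.ext (T.hexSub_inj i.2 j.2 h)

end HexTree

/-! ### Alternating hexagons and a perfect matching -/

/-- The vertices of an alternating hexagon are matched inside the hexagon. -/
theorem IsAlternatingHexagon.exists_adj {V : Type*} [Finite V] {G : SimpleGraph V}
    {M H : G.Subgraph} (h : IsAlternatingHexagon M H) (hM : M.IsMatching) (hH : IsHexagon H)
    {x : V} (hx : x ∈ H.verts) : ∃ y, H.Adj x y ∧ M.Adj x y := by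
  classical
  have := Fintype.ofFinite V
  let K := (H ⊓ M).spanningCoe
  have hK : ∀ x y, K.Adj x y ↔ H.Adj x y ∧ M.Adj x y := fun x y => Iff.rfl
  have hE : K.edgeFinset.card = 3 := by
    rw [← h, ← Set.ncard_coe_finset, coe_edgeFinset, Subgraph.edgeSet_spanningCoe,
      Subgraph.edgeSet_inf]
  have hdeg := K.sum_degrees_eq_twice_card_edges
  rw [hE] at hdeg
  let S : Finset V := Finset.univ.filter fun x => ∃ y, H.Adj x y ∧ M.Adj x y
  -- The common edges of `H` and `M` have degree sum `2 * 3 = 6` with all degrees at most one, so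
  -- they cover six vertices, which is all of `H`.
  have hle : ∀ x, K.degree x ≤ if x ∈ S then 1 else 0 := by
    intro x
    split_ifs with hxS
    · rw [← card_neighborFinset_eq_degree, Finset.card_le_one]
      intro a ha b hb
      rw [mem_neighborFinset, hK] at ha hb
      exact hM.eq_of_adj_left ha.2 hb.2
    · rw [Nat.le_zero, ← card_neighborFinset_eq_degree, Finset.card_eq_zero,
        Finset.eq_empty_iff_forall_notMem]
      intro a ha
      rw [mem_neighborFinset, hK] at ha
      exact hxS (Finset.mem_filter.2 ⟨Finset.mem_univ _, a, ha⟩)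
  have hS : 6 ≤ S.card := by
    have h1 := Finset.sum_le_sum fun x (_ : x ∈ Finset.univ) => hle x
    rw [hdeg, Finset.sum_ite_mem, Finset.univ_inter, Finset.sum_const, smul_eq_mul,
      mul_one] at h1
    exact h1
  have hsub : (S : Set V) ⊆ H.verts := by
    intro y hy
    obtain ⟨_, z, hz, _⟩ := Finset.mem_filter.1 (Finset.mem_coe.1 hy)
    exact hz.fst_mem
  have heq := Set.eq_of_subset_of_ncard_le hsub
    (by rw [hH.ncard_verts, Set.ncard_coe_finset]; exact hS) (Set.toFinite _)
  rw [← heq] at hx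
  exact (Finset.mem_filter.1 (Finset.mem_coe.1 hx)).2

namespace HexTree

section Matching

variable (T : HexTree)

/-- The perfect matching that pairs `2 * t` with `2 * t + 1`. -/
def pairMatching {n : ℕ} (hn : 0 < n) : (T.graph n).Subgraph where
  verts := Set.univ
  Adj x y := x ≠ y ∧ (x : ℕ) / 2 = y / 2
  adj_sub := by
    have key : ∀ x y : Fin (4 * n + 2), (x : ℕ) < y → (x : ℕ) / 2 = y / 2 →
        T.HexAdj n x y := by
      intro x y h1 h2
      have h3 : (y : ℕ) = x + 1 := by omega
      rcases vertex_cases x with e | e | ⟨i, e | e | e | e⟩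
      · have := T.hexAdj_prv hn x.2
        rwa [e, prv_zero, ← (show (y : ℕ) = 1 by omega), ← e] at this
      · omega
      · have := T.hexAdj_nxt hn x.2
        rwa [e, nxt_two, ← (show (y : ℕ) = 4 * i + 3 by omega), ← e] at this
      · omega
      · have := T.hexAdj_nxt hn x.2
        rwa [e, nxt_four, ← (show (y : ℕ) = 4 * i + 5 by omega), ← e] at this
      · omega
    rintro x y ⟨hne, h⟩
    have hne' : (x : ℕ) ≠ y := fun e => hne (Fin.ext e)
    rcases hne'.lt_or_gt with h1 | h1
    · exact key x y h1 h
    · exact (key y x h1 h.symm).symm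
  edge_vert _ := Set.mem_univ _
  symm := ⟨fun _ _ h => ⟨h.1.symm, h.2.symm⟩⟩

theorem isPerfectMatching_pairMatching {n : ℕ} (hn : 0 < n) :
    (T.pairMatching hn).IsPerfectMatching := by
  refine ⟨?_, fun x => Set.mem_univ x⟩
  intro x _
  have hx := x.2
  let y : Fin (4 * n + 2) := 
    ⟨if (x : ℕ) % 2 = 0 then (x : ℕ) + 1 else (x : ℕ) - 1, by split_ifs <;> omega⟩
  have hy : (y : ℕ) = if (x : ℕ) % 2 = 0 then (x : ℕ) + 1 else (x : ℕ) - 1 := rfl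
  refine ⟨y, ⟨fun e => ?_, ?_⟩, ?_⟩
  · have := congrArg Fin.val e
    rw [hy] at this
    split_ifs at this <;> omega
  · rw [hy]; split_ifs <;> omega
  · rintro z ⟨hne, hz⟩
    have hne' : (x : ℕ) ≠ z := fun e => hne (Fin.ext e)
    apply Fin.ext
    rw [hy]; split_ifs <;> omega

theorem isAlternatingHexagon_pairMatching {n i : ℕ} (hn : 0 < n) (hi : i < n)
    (he : T.att i % 2 = 0) : IsAlternatingHexagon (T.pairMatching hn) (T.hexSub n i) := by
  have hle := T.att_le i
  let p (a b : ℕ) (ha : a < 4 * n + 2) (hb : b < 4 * n + 2) : Sym2 (Fin (4 * n + 2)) :=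
    s(⟨a, ha⟩, ⟨b, hb⟩)
  have hp : ∀ a b ha hb (x y : Fin (4 * n + 2)), s(x, y) = p a b ha hb ↔
      ((x : ℕ) = a ∧ (y : ℕ) = b) ∨ ((x : ℕ) = b ∧ (y : ℕ) = a) := by
    intro a b ha hb x y
    simp only [p, Sym2.eq_iff, Fin.ext_iff]
  have hp' : ∀ a b ha hb c d hc hd, a < b → b < c → c < d → p a b ha hb ≠ p c d hc hd := by
    intro a b ha hb c d hc hd h1 h2 h3 h
    rcases (hp c d hc hd _ _).1 h with ⟨h4, h5⟩ | ⟨h4, h5⟩ <;> simp at h4 h5 <;> omega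
  unfold IsAlternatingHexagon
  rw [Set.ncard_eq_three]
  refine ⟨p (T.att i) (T.att i + 1) (by omega) (by omega),
    p (4 * i + 2) (4 * i + 3) (by omega) (by omega),
    p (4 * i + 4) (4 * i + 5) (by omega) (by omega), hp' _ _ _ _ _ _ _ _ (by omega) (by omega)
    (by omega), hp' _ _ _ _ _ _ _ _ (by omega) (by omega) (by omega),
    hp' _ _ _ _ _ _ _ _ (by omega) (by omega) (by omega), ?_⟩
  ext e
  induction e with
  | _ x y =>
    simp only [Set.mem_inter_iff, Subgraph.mem_edgeSet, T.hexSub_adj hi, Set.mem_insert_iff,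
      Set.mem_singleton_iff, hp]
    change _ ∧ (x ≠ y ∧ (x : ℕ) / 2 = y / 2) ↔ _
    rw [Ne, Fin.ext_iff]
    generalize (x : ℕ) = a
    generalize (y : ℕ) = b
    unfold Follows
    generalize T.att i = c at *
    constructor
    · rintro ⟨h | h, _, h2⟩
      · rcases h with h | h | h | h <;> omega
      · rcases h with h | h | h | h <;> omega
    · rintro (h | h | h) <;> rcases h with ⟨rfl, rfl⟩ | ⟨rfl, rfl⟩ <;>
        refine ⟨?_, by omega, by omega⟩ <;> omega

/-- The two ways in which an alternating hexagon is matched. -/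
theorem matched_of_isAlternatingHexagon {n i : ℕ} (hi : i < n) {M : (T.graph n).Subgraph}
    (hM : M.IsPerfectMatching) (h : IsAlternatingHexagon M (T.hexSub n i))
    {u a b : Fin (4 * n + 2)} (hu : (u : ℕ) = T.att i) (ha : (a : ℕ) = 4 * i + 2)
    (hb : (b : ℕ) = 4 * i + 3) :
    ((∃ v : Fin (4 * n + 2), (v : ℕ) = T.att i + 1 ∧ M.Adj u v) ∧ M.Adj a b) ∨
      (M.Adj u a ∧ ∃ c : Fin (4 * n + 2), (c : ℕ) = 4 * i + 4 ∧ M.Adj b c) := by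
  have hle := T.att_le i
  have hH := T.isHexagon_hexSub hi
  have key : ∀ x : Fin (4 * n + 2), (x : ℕ) ∈ T.hexSet i →
      ∃ y : Fin (4 * n + 2), (T.Follows i x y ∨ T.Follows i y x) ∧ M.Adj x y := by
    intro x hx
    obtain ⟨y, h1, h2⟩ := h.exists_adj hM.1 hH (x := x) hx
    exact ⟨y, (T.hexSub_adj hi).1 h1, h2⟩
  obtain ⟨y, h1, h2⟩ := key a (by rw [mem_hexSet]; omega)
  have h3 : (y : ℕ) = T.att i ∨ (y : ℕ) = 4 * i + 3 := by
    unfold Follows at h1; omega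
  rcases h3 with h3 | h3
  · right
    have e : y = u := Fin.ext (h3.trans hu.symm)
    subst e
    refine ⟨h2.symm, ?_⟩
    obtain ⟨z, h4, h5⟩ := key b (by rw [mem_hexSet]; omega)
    have h6 : (z : ℕ) = 4 * i + 2 ∨ (z : ℕ) = 4 * i + 4 := by
      unfold Follows at h4; omega
    rcases h6 with h6 | h6
    · have e : z = a := Fin.ext (h6.trans ha.symm)
      subst e
      have := congrArg Fin.val (hM.1.eq_of_adj_left h2 h5.symm)
      omega
    · exact ⟨z, h6, h5⟩
  · left
    have e : y = b := Fin.ext (h3.trans hb.symm)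
    subst e
    refine ⟨?_, h2⟩
    obtain ⟨z, h4, h5⟩ := key u (by rw [mem_hexSet]; omega)
    have h6 : (z : ℕ) = 4 * i + 2 ∨ (z : ℕ) = T.att i + 1 := by
      unfold Follows at h4; omega
    rcases h6 with h6 | h6
    · have e : z = a := Fin.ext (h6.trans ha.symm)
      subst e
      have := congrArg Fin.val (hM.1.eq_of_adj_left h2 h5.symm)
      omega
    · exact ⟨z, h6, h5⟩

theorem hexSet_disjoint_of_hexSub {n i j : ℕ} (hi : i < n)
    (h : Disjoint (T.hexSub n i).verts (T.hexSub n j).verts) :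
    Disjoint (T.hexSet i) (T.hexSet j) := by
  rw [Set.disjoint_left] at h ⊢
  intro x hx hx'
  exact h (a := ⟨x, T.lt_of_mem_hexSet hi hx⟩) hx hx'

end Matching

/-! ### The caterpillar and its Clar number -/

/-- The hexagon tree formed by a straight chain of hexagons `0, …, s + 1`, continued by a
caterpillar in which every third hexagon `s + 1, s + 4, …` is branching. -/
def caterpillar (s : ℕ) : HexTree where
  -- Truncated subtraction puts `0 < i ≤ s + 1` in the first residue class: `4 * i - 1 = 4 * (i - 1)
  -- + 3` starts the edge of hexagon `i - 1` opposite to its own glued edge. In the other classes,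
  -- `4 * i - 2 = 4 * (i - 1) + 2` and `4 * i - 4 = 4 * (i - 2) + 4` start the two side edges of one
  -- branching hexagon.
  att i := if i = 0 then 0 else if (i - (s + 1)) % 3 = 0 then 4 * i - 1 else
    if (i - (s + 1)) % 3 = 1 then 4 * i - 2 else 4 * i - 4
  att_zero := by simp
  att_succ i := by
    rw [if_neg (Nat.succ_ne_zero i)]
    split_ifs <;> omega
  att_le i := by split_ifs <;> omega
  att_mod i := by split_ifs <;> omega

theorem caterpillar_att (s i : ℕ) : (caterpillar s).att i =
    if i = 0 then 0 else if (i - (s + 1)) % 3 = 0 then 4 * i - 1 else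
    if (i - (s + 1)) % 3 = 1 then 4 * i - 2 else 4 * i - 4 := rfl

theorem caterpillar_att_chain {s i : ℕ} (hi : i ≤ s) :
    (caterpillar s).att (i + 1) = 4 * i + 3 := by
  rw [caterpillar_att, if_neg (by omega), if_pos (by omega)]
  omega

theorem caterpillar_hexAdj {n s i y : ℕ} (hi : i ≤ s) (hn : i < n)
    (h : (caterpillar s).HexAdj n (4 * i + 2) y) :
    y = (caterpillar s).att i ∨ y = 4 * i + 3 := by
  rw [hexAdj_iff _ (by omega) (by omega), nxt_two, prv_two] at h
  rcases h with h | h | h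
  · exact Or.inr h
  · exact Or.inl h
  · rcases (caterpillar s).third_cases n (4 * i + 2) with
      ⟨j, h1, h2, h3, h4⟩ | ⟨j, h1, h2, h3, h4⟩ | ⟨_, h4⟩
    · rw [caterpillar_att] at h3
      split_ifs at h3 <;> omega
    · have := (caterpillar s).att_mod j
      omega
    · rw [prv_two] at h4
      exact Or.inl (h.trans h4)

/-- In a straight chain there is at most one hexagon of a resonant set. -/
theorem chain_unique (T : HexTree) {n s i j : ℕ} (hij : i < j) (hj : j ≤ s) (hn : j < n)
    (hatt : ∀ k, k ≤ s → T.att (k + 1) = 4 * k + 3)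
    (hadj : ∀ k y, k ≤ s → k < n → T.HexAdj n (4 * k + 2) y → y = T.att k ∨ y = 4 * k + 3)
    {M : (T.graph n).Subgraph} (hM : M.IsPerfectMatching)
    (hi' : IsAlternatingHexagon M (T.hexSub n i)) (hj' : IsAlternatingHexagon M (T.hexSub n j))
    (hd : Disjoint (T.hexSet i) (T.hexSet j)) : False := by
  -- Consecutive hexagons of the chain share the vertex `4 * i + 3`.
  have hij2 : i + 2 ≤ j := by
    by_contra hlt
    have e : j = i + 1 := by omega
    subst e
    rw [Set.disjoint_left] at hd
    exact hd (a := 4 * i + 3) (by rw [mem_hexSet]; omega)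
      (by rw [mem_hexSet, hatt i (by omega)]; omega)
  have hle : ∀ k, k < n → T.att k < 4 * n + 2 := fun k hk => by have := T.att_le k; omega
  let N : ℕ → ℕ → Prop := fun x y => ∃ x' y' : Fin (4 * n + 2), (x' : ℕ) = x ∧ (y' : ℕ) = y ∧
    M.Adj x' y'
  have hsymm : ∀ x y, N x y → N y x := by
    rintro x y ⟨x', y', h1, h2, h3⟩
    exact ⟨y', x', h2, h1, h3.symm⟩
  have huniq : ∀ x y z, N x y → N x z → y = z := by
    rintro x y z ⟨x', y', h1, h2, h3⟩ ⟨x'', z', h4, h5, h6⟩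
    have e : x' = x'' := Fin.ext (h1.trans h4.symm)
    subst e
    rw [← h2, ← h5, hM.1.eq_of_adj_left h3 h6]
  have halt : ∀ k, k < n → IsAlternatingHexagon M (T.hexSub n k) →
      (N (T.att k) (T.att k + 1) ∧ N (4 * k + 2) (4 * k + 3)) ∨
        (N (T.att k) (4 * k + 2) ∧ N (4 * k + 3) (4 * k + 4)) := by
    intro k hk h
    rcases T.matched_of_isAlternatingHexagon hk hM h (u := ⟨T.att k, hle k hk⟩)
      (a := ⟨4 * k + 2, by omega⟩) (b := ⟨4 * k + 3, by omega⟩) rfl rfl rfl with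
      ⟨⟨v, hv, h1⟩, h2⟩ | ⟨h1, c, hc, h2⟩
    · exact Or.inl ⟨⟨_, v, rfl, hv, h1⟩, ⟨_, _, rfl, rfl, h2⟩⟩
    · exact Or.inr ⟨⟨_, _, rfl, rfl, h1⟩, ⟨_, c, rfl, hc, h2⟩⟩
  -- In the chain `4 * k + 2` has degree two, so the matching has only one alternative. That
  -- alternative uses up `4 * k + 3 = att (k + 1)`, and the same situation recurs in hexagon `k +
  -- 1`.
  have step : ∀ k, k ≤ s → k < n → ¬ N (T.att k) (4 * k + 2) → N (4 * k + 2) (4 * k + 3) := by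
    intro k hk hkn h
    obtain ⟨y, hy, _⟩ := hM.1 (hM.2 (⟨4 * k + 2, by omega⟩ : Fin (4 * n + 2)))
    have hN : N (4 * k + 2) y := ⟨_, y, rfl, rfl, hy⟩
    rcases hadj k y hk hkn hy.adj_sub with e | e
    · rw [e] at hN
      exact absurd (hsymm _ _ hN) h
    · rwa [e] at hN
  have step' : ∀ k, k + 1 ≤ s → k + 1 < n → N (4 * k + 2) (4 * k + 3) →
      N (4 * (k + 1) + 2) (4 * (k + 1) + 3) := by
    intro k hk hkn h
    apply step (k + 1) hk hkn
    rw [hatt k (by omega)]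
    intro h'
    have := huniq _ _ _ (hsymm _ _ h) h'
    omega
  -- Both ways of alternating on hexagon `i` match `4 * i + 3` inside that hexagon, so it is
  -- unavailable to hexagon `i + 1`.
  have start : N (4 * (i + 1) + 2) (4 * (i + 1) + 3) := by
    rcases halt i (by omega) hi' with ⟨_, h⟩ | ⟨_, h⟩
    · exact step' i (by omega) (by omega) h
    · apply step (i + 1) (by omega) (by omega)
      rw [hatt i (by omega)]
      intro h'
      have := huniq _ _ _ h h'
      omega
  have all : ∀ k, i + 1 ≤ k → k ≤ s → k < n → N (4 * k + 2) (4 * k + 3) := by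
    intro k hk
    induction k, hk using Nat.le_induction with
    | base => intro _ _; exact start
    | succ k _ ih => intro h1 h2; exact step' k h1 h2 (ih (by omega) (by omega))
  obtain ⟨k, rfl⟩ : ∃ k, j = k + 1 := ⟨j - 1, by omega⟩
  -- The propagated edge matches `att j` to a vertex outside hexagon `j`, so `j` cannot be
  -- alternating.
  have h1 := hsymm _ _ (all k (by omega) (by omega) (by omega))
  have h2 := halt (k + 1) hn hj'
  rw [hatt k (by omega)] at h2
  rcases h2 with ⟨h2, _⟩ | ⟨h2, _⟩
  · have := huniq _ _ _ h1 h2; omega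
  · have := huniq _ _ _ h1 h2; omega

theorem caterpillar_hexSet_subset {n s i : ℕ} (hs : s < i) (hi : i < n) {x : ℕ}
    (hx : x ∈ (caterpillar s).hexSet i) :
    x = 4 * s + 3 ∨ x = 4 * s + 4 ∨ (4 * s + 6 ≤ x ∧ x < 4 * n + 2) := by
  have h := (caterpillar s).lt_of_mem_hexSet hi hx
  rw [mem_hexSet, caterpillar_att] at hx
  split_ifs at hx <;> omega

/-- Hexagons after `s` use only their own new vertices, four for each, and the two ends of the edge
glued to hexagon `s`; disjoint ones use six vertices each. -/
theorem card_le_of_pairwise_disjoint {n s : ℕ} (hs : s < n) {J : Finset ℕ}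
    (hJ : ∀ i ∈ J, s < i ∧ i < n)
    (hd : ∀ i ∈ J, ∀ j ∈ J, i ≠ j →
      Disjoint ((caterpillar s).hexSet i) ((caterpillar s).hexSet j)) :
    6 * J.card ≤ 4 * (n - s - 1) + 2 := by
  classical
  let F : ℕ → Finset ℕ := fun i => Finset.univ.image ((caterpillar s).hexVert i)
  have hF : ∀ i, (F i).card = 6 := by
    intro i
    rw [Finset.card_image_of_injective _ (hexVert_injective _ i), Finset.card_univ,
      Fintype.card_fin]
  have hmem : ∀ i x, x ∈ F i → x ∈ (caterpillar s).hexSet i := by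
    intro i x hx
    obtain ⟨k, _, rfl⟩ := Finset.mem_image.1 hx
    exact hexVert_mem _ i k
  have hcard : (J.biUnion F).card = J.card * 6 := by
    rw [Finset.card_biUnion, Finset.sum_const_nat fun i _ => hF i]
    · intro i hi j hj hij
      rw [Function.onFun, Finset.disjoint_left]
      intro x hx hx'
      exact Set.disjoint_left.1 (hd i hi j hj hij) (hmem i x hx) (hmem j x hx')
  have hsub : J.biUnion F ⊆
      insert (4 * s + 3) (insert (4 * s + 4) (Finset.Ico (4 * s + 6) (4 * n + 2))) := by
    intro x hx
    obtain ⟨i, hi, hx⟩ := Finset.mem_biUnion.1 hx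
    simp only [Finset.mem_insert, Finset.mem_Ico]
    exact caterpillar_hexSet_subset (hJ i hi).1 (hJ i hi).2 (hmem i x hx)
  have h1 := Finset.card_le_card hsub
  have h2 := Finset.card_insert_le (4 * s + 3)
    (insert (4 * s + 4) (Finset.Ico (4 * s + 6) (4 * n + 2)))
  have h3 := Finset.card_insert_le (4 * s + 4) (Finset.Ico (4 * s + 6) (4 * n + 2))
  rw [Nat.card_Ico] at h3
  omega

theorem caterpillar_card_le {n s : ℕ} (hs : s < n)
    {C : Finset ((caterpillar s).graph n).Subgraph} (hC : IsResonantSet C) :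
    6 * C.card ≤ 4 * (n - s - 1) + 8 := by
  classical
  obtain ⟨h1, h2, M, hM, h3⟩ := hC
  have hn : 0 < n := by omega
  let J := (Finset.range n).filter fun i => (caterpillar s).hexSub n i ∈ C
  have hJ : ∀ i ∈ J, i < n ∧ (caterpillar s).hexSub n i ∈ C := by
    intro i hi
    simpa [J] using hi
  have hd : ∀ i ∈ J, ∀ j ∈ J, i ≠ j →
      Disjoint ((caterpillar s).hexSet i) ((caterpillar s).hexSet j) := by
    intro i hi j hj hij
    apply hexSet_disjoint_of_hexSub _ (hJ i hi).1
    exact h2 _ (hJ i hi).2 _ (hJ j hj).2 fun e => hij (hexSub_inj _ (hJ i hi).1 (hJ j hj).1 e)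
  have hCJ : C.card ≤ J.card := by
    refine (Finset.card_le_card (t := J.image fun i => (caterpillar s).hexSub n i) ?_).trans
      Finset.card_image_le
    intro H hH
    obtain ⟨i, hi, rfl⟩ := ((caterpillar s).isHexagon_iff hn).1 (h1 H hH)
    exact Finset.mem_image.2 ⟨i, by simp [J, hi, hH], rfl⟩
  have hJ1 : (J.filter fun i => i ≤ s).card ≤ 1 := by
    rw [Finset.card_le_one]
    intro i hi j hj
    rw [Finset.mem_filter] at hi hj
    obtain ⟨hi, his⟩ := hi
    obtain ⟨hj, hjs⟩ := hj
    by_contra hij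
    rcases Ne.lt_or_gt hij with h | h
    · exact chain_unique _ h hjs (hJ j hj).1 (fun _ => caterpillar_att_chain)
        (fun _ _ => caterpillar_hexAdj) hM (h3 _ (hJ i hi).2) (h3 _ (hJ j hj).2)
        (hd i hi j hj hij)
    · exact chain_unique _ h his (hJ i hi).1 (fun _ => caterpillar_att_chain)
        (fun _ _ => caterpillar_hexAdj) hM (h3 _ (hJ j hj).2) (h3 _ (hJ i hi).2)
        (hd j hj i hi (Ne.symm hij))
  have hJ2 : 6 * (J.filter fun i => ¬ i ≤ s).card ≤ 4 * (n - s - 1) + 2 := by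
    apply card_le_of_pairwise_disjoint hs
    · intro i hi
      rw [Finset.mem_filter] at hi
      exact ⟨by omega, (hJ i hi.1).1⟩
    · intro i hi j hj
      exact hd i (Finset.mem_filter.1 hi).1 j (Finset.mem_filter.1 hj).1
  have := Finset.card_filter_add_card_filter_not (s := J) fun i => i ≤ s
  omega

/-- The hexagons of a maximum resonant set of the caterpillar. -/
def clarIndices (s n : ℕ) : Finset ℕ :=
  -- By truncated subtraction the second condition fails for all `i ≤ s + 1`, so hexagon `0` is the
  -- sole representative of the chain.
  (Finset.range n).filter fun i => i = 0 ∨ (i - (s + 1)) % 3 ≠ 0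

theorem card_clarIndices (s r : ℕ) : (clarIndices s (s + 1 + r)).card = 1 + 2 * r / 3 := by
  induction r with
  | zero =>
    have : clarIndices s (s + 1 + 0) = {0} := by
      ext i
      simp only [clarIndices, Finset.mem_filter, Finset.mem_range, Finset.mem_singleton]
      omega
    rw [this]
    rfl
  | succ r ih =>
    rw [clarIndices, ← add_assoc, Finset.range_add_one, Finset.filter_insert]
    obtain ⟨q, hq⟩ : ∃ q, r = 3 * q ∨ r = 3 * q + 1 ∨ r = 3 * q + 2 := ⟨r / 3, by omega⟩
    split_ifs with h
    · rw [Finset.card_insert_of_notMem (by simp)]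
      change (clarIndices s (s + 1 + r)).card + 1 = _
      omega
    · change (clarIndices s (s + 1 + r)).card = _
      omega

theorem exists_isResonantSet_caterpillar {s n : ℕ} (hn : 0 < n) :
    ∃ C : Finset ((caterpillar s).graph n).Subgraph,
      IsResonantSet C ∧ C.card = (clarIndices s n).card := by
  classical
  have hI : ∀ i ∈ clarIndices s n, i < n ∧ (i = 0 ∨ (i - (s + 1)) % 3 ≠ 0) := by
    intro i hi
    simpa [clarIndices] using hi
  have hd : ∀ i ∈ clarIndices s n, ∀ j ∈ clarIndices s n, i < j →
      Disjoint ((caterpillar s).hexSub n i).verts ((caterpillar s).hexSub n j).verts := by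
    intro i hi j hj hij
    rw [Set.disjoint_left]
    intro x hx hx'
    obtain ⟨_, h, _⟩ := hexSet_inter _ hij hx hx'
    have h1 := (hI i hi).2
    have h2 := (hI j hj).2
    have h3 := (caterpillar s).att_sep hij
    rw [mem_hexSet] at h
    have h4 : 4 * i + 2 ≤ (caterpillar s).att j ∧ (caterpillar s).att j ≤ 4 * i + 5 := by omega
    rw [caterpillar_att s j] at h4
    split_ifs at h4 <;> omega
  refine ⟨(clarIndices s n).image fun i => (caterpillar s).hexSub n i, ⟨?_, ?_,
    (caterpillar s).pairMatching hn, isPerfectMatching_pairMatching _ hn, ?_⟩, ?_⟩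
  · intro H hH
    obtain ⟨i, hi, rfl⟩ := Finset.mem_image.1 hH
    exact isHexagon_hexSub _ (hI i hi).1
  · intro H₁ hH₁ H₂ hH₂ hne
    obtain ⟨i, hi, rfl⟩ := Finset.mem_image.1 hH₁
    obtain ⟨j, hj, rfl⟩ := Finset.mem_image.1 hH₂
    rcases lt_trichotomy i j with h | rfl | h
    · exact hd i hi j hj h
    · exact absurd rfl hne
    · exact (hd j hj i hi h).symm
  · intro H hH
    obtain ⟨i, hi, rfl⟩ := Finset.mem_image.1 hH
    apply isAlternatingHexagon_pairMatching _ hn (hI i hi).1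
    have h := (hI i hi).2
    rw [caterpillar_att]
    split_ifs <;> omega
  · rw [Finset.card_image_of_injOn]
    intro i hi j hj h
    exact hexSub_inj _ (hI i hi).1 (hI j hj).1 h

/-- The Clar number of the caterpillar. -/
theorem hasClarNumber_caterpillar {s r c : ℕ} (hc : c = 1 + 2 * r / 3) (hr : r % 3 ≠ 1) :
    ((caterpillar s).graph (s + 1 + r)).HasClarNumber c := by
  constructor
  · obtain ⟨C, hC, h⟩ := exists_isResonantSet_caterpillar (s := s) (n := s + 1 + r) (by omega)
    exact ⟨C, hC, by rw [h, card_clarIndices, hc]⟩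
  · rintro k ⟨C, hC, rfl⟩
    -- The bound reads `1 + (2 * r + 1) / 3`; its floor exceeds `1 + 2 * r / 3` exactly when `r % 3
    -- = 1`.
    have := caterpillar_card_le (by omega) hC
    omega

end HexTree

end SimpleGraph

theorem mainTheorem3 (n : ℕ) (hn : 1 ≤ n) (c : ℕ) (hc : 1 ≤ c) (hcn : c ≤ (2 * n + 1) / 3) :
    ∃ (V : Type) (B : SimpleGraph V),
      B.IsCatacondensedBenzenoid ∧ B.numHexagons = n ∧ B.HasClarNumber c := by
  obtain ⟨s, r, rfl, h, hr⟩ : ∃ s r, n = s + 1 + r ∧ c = 1 + 2 * r / 3 ∧ r % 3 ≠ 1 := by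
    -- Odd `c` takes `r = 3 * k` and even `c` takes `r = 3 * k + 2`; the bound on `c` is what leaves
    -- `n - 1 - r` nonnegative.
    obtain ⟨k, hk | hk⟩ : ∃ k, c = 2 * k + 1 ∨ c = 2 * k + 2 := ⟨(c - 1) / 2, by omega⟩
    · exact ⟨n - 1 - 3 * k, 3 * k, by omega, by omega, by omega⟩
    · exact ⟨n - 1 - (3 * k + 2), 3 * k + 2, by omega, by omega, by omega⟩
  exact ⟨_, (SimpleGraph.HexTree.caterpillar s).graph (s + 1 + r),
    SimpleGraph.HexTree.isCatacondensedBenzenoid _ hn,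
    SimpleGraph.HexTree.numHexagons_graph _ hn,
    SimpleGraph.HexTree.hasClarNumber_caterpillar h hr⟩
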